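/- **Setting.** Fix $N\ge 1$. Consider formal series $X=\sum_{j\in\mathbb Z}X_j(n)\Lambda^j$ with $X_j:\mathbb Z\to M_N(\mathbb C)$, multiplied by the rule $(X(n)\Lambda^i)(Y(n)\Lambda^j)=X(n)Y(n+i)\Lambda^{i+j}$. Let $\mathfrak g$ be an associative algebra of such series: a complex linear space of series on which all products are given by (unconditionally) convergent sums and are associative, which contains the $X(n)\Lambda^j$ with $X$ bounded, and which splits as $\mathfrak g=\mathfrak g_+\dotplus\mathfrak g_-$, where $\mathfrak g_+$ (resp. $\mathfrak g_-$) consists of the elements involving only $\Lambda^j$ with $j\ge 0$ (resp. $j<0$). Let $\mathcal S=\{1,\dots,N\}\cup\{\bar 1,\dots,\bar N\}$. Let $\boldsymbol s=(s_a)_{a\in\mathcal S}\in\mathbb Z^{\mathcal S}$ be discrete times with $\sum_{a\in\mathcal S}s_a=0$, and let $\boldsymbol t=(t_{ja})_{j\ge 1,\,a\in\mathcal S}$ be continuous times, treated as formal variables: all objects are formal power series in $\boldsymbol t$, and $\partial_{ja}=\partial/\partial t_{ja}$. Let $G_-$ (resp. $G_+$) be the group of invertible elements of $\mathfrak g[[\boldsymbol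 t]]$ which, together with their inverses, have the form $1+\sum_{j<0}X_j(n)\Lambda^j$ (resp. $\sum_{j\ge 0}X_j(n)\Lambda^j$). Put $$W_0=\sum_{k=1}^N E_{kk}\Lambda^{s_k}\exp\Big(\sum_{j\ge1}t_{jk}\Lambda^j\Big),\qquad \bar W_0=\sum_{k=1}^N E_{kk}\Lambda^{-s_{\bar k}}\exp\Big(\sum_{j\ge1}t_{j\bar k}\Lambda^{-j}\Big).$$ Let $g\in\mathfrak g$ be invertible and independent of $\boldsymbol s,\boldsymbol t$, and suppose that for every $\boldsymbol s$ in the zero charge sector $$S\,W_0\,g=\bar S\,\bar W_0,\qquad S=1+\sum_{i\ge1}\varphi_i(n)\Lambda^{-i}\in G_-,\quad \bar S=\sum_{i\ge0}\bar\varphi_i(n)\Lambda^{i}\in G_+ .$$ Let $W=S W_0$ and $\bar W=\bar S\bar W_0$ be the dressing operators. **Scalar Lax operators.** For $a\neq b$ in $\mathcal S$ let $T_{(a,b)}$ be the shift $s_a\mapsto s_a+1,\ s_b\mapsto s_b-1$. Fix any $a_0\in\mathcal S\setminus\{1\}$ and any $\bar a_0\in\mathcal S\setminus\{\bar 1\}$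 and set $$\mathcal T_1=T_{(1,a_0)},\quad \mathcal T_a=T_{(a,1)}\ (a\ne1),\qquad \bar{\mathcal T}_{\bar1}=T_{(\bar1,\bar a_0)},\quad \bar{\mathcal T}_a=T_{(a,\bar1)}\ (a\neq\bar1).$$ Define the scalar dressing operators $$\mathcal K_a=\begin{cases}1+\sum_{i\ge1}\varphi_{i,11}\mathcal T_1^{-i},&a=1,\\ \sum_{i\ge0}\varphi_{i+1,1k}\mathcal T_k^{-i},&a=k\neq1,\\ \sum_{i\ge0}\bar\varphi_{i,1k}\mathcal T_{\bar k}^{-i},&a=\bar k,\end{cases}$$ let $\bar{\mathcal K}_a$ be given by the same coefficients with $\bar{\mathcal T}_a$ in place of $\mathcal T_a$, and put $\mathcal L_a=\mathcal K_a\circ\mathcal T_a\circ\mathcal K_a^{-1}$, $\bar{\mathcal L}_a=\bar{\mathcal K}_a\circ\bar{\mathcal T}_a\circ\bar{\mathcal K}_a^{-1}$. **Projections.** For $P=\sum_i c_i\mathcal T_a^i$ with finitely many positive powers, $P_+=\sum_{i\ge0}c_i\mathcal T_1^i$ if $a=1$ and $P_+=\sum_{i>0}c_i\mathcal T_a^i$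 if $a\ne1$. For $P=\sum_i c_i\bar{\mathcal T}_a^i$ with finitely many positive powers, $$P_+=\begin{cases}\sum_{i\ge0}c_i\bar{\mathcal T}_1^i,&a=1,\\ \sum_{i>0}c_i\bar{\mathcal T}_{\bar1}^i,&a=\bar1\text{ and }\bar a_0=1,\\ \sum_{i>0}c_i(\bar{\mathcal T}_a^i-1),&\text{otherwise.}\end{cases}$$ Such scalar operators act on $\boldsymbol s$-dependent series in $\Lambda$ by shifting $\boldsymbol s$ and multiplying from the left by the scalar coefficients $c_i=c_i(n,\boldsymbol s,\boldsymbol t)$. **Theorem.** For every $a\in\mathcal S$ the operators $\mathcal K_a$ and $\bar{\mathcal K}_a$ are invertible (so $\mathcal L_a$ and $\bar{\mathcal L}_a$ are defined), and for every $j\ge1$ and every $\boldsymbol s$ in the zero charge sector $$\partial_{ja}(E_{11}W)=(\mathcal L_a^j)_+(E_{11}W)=(\bar{\mathcal L}_a^j)_+(E_{11}W),\qquad \partial_{ja}(E_{11}\bar W)=(\mathcal L_a^j)_+(E_{11}\bar W)=(\bar{\mathcal L}_a^j)_+(E_{11}\bar W).$$ -/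

import Mathlib

noncomputable section

namespace Toda

/-! ### Laurent series in the shift operator `Λ` -/

/-- A (possibly two-sided infinite) formal Laurent series `X = ∑_{j ∈ ℤ} X_j(n) Λ^j` in the shift
operator, with coefficients sequences `X_j : ℤ → M_N(ℂ)`; here `X j n` is `X_j(n)`. -/
abbrev ShiftSeries (N : ℕ) : Type := ℤ → ℤ → Matrix (Fin N) (Fin N) ℂ

namespace ShiftSeries

variable {N : ℕ}

/-- The monomial `X(n) Λ^j`. -/
def monomial (j : ℤ) (X : ℤ → Matrix (Fin N) (Fin N) ℂ) : ShiftSeries N := Pi.single j X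

/-- The product determined by `(X(n) Λ^i)(Y(n) Λ^j) = X(n) Y(n+i) Λ^(i+j)`. -/
def mul (X Y : ShiftSeries N) : ShiftSeries N :=
  fun m n => ∑' i : ℤ, X i n * Y (m - i) (n + i)

/-- The part `∑_{j ≥ 0} X_j(n) Λ^j`. -/
def plus (X : ShiftSeries N) : ShiftSeries N := fun j n => if 0 ≤ j then X j n else 0

/-- The series belongs to `𝔤₊`: only powers `Λ^j` with `j ≥ 0` occur. -/
def IsPlus (X : ShiftSeries N) : Prop := ∀ j < 0, ∀ n, X j n = 0

/-- The series belongs to `𝔤₋`: only powers `Λ^j` with `j < 0` occur. -/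
def IsMinus (X : ShiftSeries N) : Prop := ∀ j, 0 ≤ j → ∀ n, X j n = 0

end ShiftSeries

/-- An associative algebra `𝔤` of Laurent series in `Λ`. The set of all two-sided infinite series
is not closed under the product, so `𝔤` is any linear space of such series on which the product is
given by convergent sums and is an associative operation, that contains the operators `X(n) Λ^j`
(for all bounded sequences `X`), and that splits as `𝔤 = 𝔤₊ ∔ 𝔤₋`. -/
structure LaurentAlgebra (N : ℕ) where
  carrier : Submodule ℂ (ShiftSeries N)
  monomial_mem : ∀ (j : ℤ) (X : ℤ → Matrix (Fin N) (Fin N) ℂ),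
    (∃ C : ℝ, ∀ n a b, ‖X n a b‖ ≤ C) → ShiftSeries.monomial j X ∈ carrier
  summable_mul : ∀ X ∈ carrier, ∀ Y ∈ carrier, ∀ m n : ℤ,
    Summable fun i : ℤ => X i n * Y (m - i) (n + i)
  mul_mem : ∀ X ∈ carrier, ∀ Y ∈ carrier, ShiftSeries.mul X Y ∈ carrier
  mul_assoc : ∀ X ∈ carrier, ∀ Y ∈ carrier, ∀ Z ∈ carrier,
    ShiftSeries.mul (ShiftSeries.mul X Y) Z = ShiftSeries.mul X (ShiftSeries.mul Y Z)
  plus_mem : ∀ X ∈ carrier, ShiftSeries.plus X ∈ carrier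

namespace LaurentAlgebra

variable {N : ℕ} (𝔤 : LaurentAlgebra N)

/-- The operators of the algebra, as a type. -/
abbrev Elt : Type := 𝔤.carrier

/-- The operator `A Λ^j` of the algebra, for a constant matrix `A`. -/
def const (j : ℤ) (A : Matrix (Fin N) (Fin N) ℂ) : 𝔤.Elt :=
  ⟨ShiftSeries.monomial j fun _ => A, 𝔤.monomial_mem j _
    ⟨∑ a, ∑ b, ‖A a b‖, fun _ a b =>
      (Finset.single_le_sum (f := fun b => ‖A a b‖) (fun _ _ => norm_nonneg _)
        (Finset.mem_univ b)).trans
      (Finset.single_le_sum (f := fun a => ∑ b, ‖A a b‖)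
        (fun _ _ => Finset.sum_nonneg fun _ _ => norm_nonneg _) (Finset.mem_univ a))⟩⟩

instance : Mul 𝔤.Elt := ⟨fun X Y => ⟨ShiftSeries.mul X Y, 𝔤.mul_mem _ X.2 _ Y.2⟩⟩

instance : One 𝔤.Elt := ⟨𝔤.const 0 1⟩

theorem coe_mul (X Y : 𝔤.Elt) :
    ((X * Y : 𝔤.Elt) : ShiftSeries N) = ShiftSeries.mul (X : ShiftSeries N) Y := rfl

theorem coe_one :
    ((1 : 𝔤.Elt) : ShiftSeries N) = ShiftSeries.monomial 0 fun _ => 1 := rfl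

theorem mul_apply (X Y : 𝔤.Elt) (m n : ℤ) :
    ((X * Y : 𝔤.Elt) : ShiftSeries N) m n
      = ∑' i : ℤ, (X : ShiftSeries N) i n * (Y : ShiftSeries N) (m - i) (n + i) := rfl

instance : Ring 𝔤.Elt :=
  { (inferInstance : AddCommGroup 𝔤.carrier),
    (inferInstance : Mul 𝔤.Elt), (inferInstance : One 𝔤.Elt) with
    left_distrib := fun X Y Z => by
      apply Subtype.ext; funext m n
      simp only [mul_apply, Submodule.coe_add, Pi.add_apply, mul_add]
      exact (𝔤.summable_mul _ X.2 _ Y.2 m n).tsum_add (𝔤.summable_mul _ X.2 _ Z.2 m n)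
    right_distrib := fun X Y Z => by
      apply Subtype.ext; funext m n
      simp only [mul_apply, Submodule.coe_add, Pi.add_apply, add_mul]
      exact (𝔤.summable_mul _ X.2 _ Z.2 m n).tsum_add (𝔤.summable_mul _ Y.2 _ Z.2 m n)
    zero_mul := fun X => by
      apply Subtype.ext; funext m n
      simp [mul_apply]
    mul_zero := fun X => by
      apply Subtype.ext; funext m n
      simp [mul_apply]
    mul_assoc := fun X Y Z => Subtype.ext (𝔤.mul_assoc _ X.2 _ Y.2 _ Z.2)
    one_mul := fun X => by
      apply Subtype.ext; funext m n
      rw [mul_apply, tsum_eq_single 0]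
      · simp [coe_one, ShiftSeries.monomial]
      · intro i hi
        simp [coe_one, ShiftSeries.monomial, hi]
    mul_one := fun X => by
      apply Subtype.ext; funext m n
      rw [mul_apply, tsum_eq_single m]
      · simp [coe_one, ShiftSeries.monomial]
      · intro i hi
        have : m - i ≠ 0 := fun h => hi (by omega)
        simp [coe_one, ShiftSeries.monomial, this] }

end LaurentAlgebra

/-! ### Indices, discrete times (charges) and continuous times -/

/-- The index set `𝒮 = 𝕊 ∪ 𝕊̄`: `Sum.inl k` is `k ∈ 𝕊` and `Sum.inr k` is `k̄ ∈ 𝕊̄`.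
The first index, written `1` on paper, is `0 : Fin N`. -/
abbrev Index (N : ℕ) : Type := Fin N ⊕ Fin N

/-- The labels of the continuous times: `(j, a)` stands for `t_{ja}`, `j = 1, 2, …`, `a ∈ 𝒮`. -/
abbrev Time (N : ℕ) : Type := ℕ+ × Index N

/-- The discrete times `s = (s_a)` in the zero charge sector `∑ s_a = 0`. -/
abbrev Charge (N : ℕ) : Type := {s : Index N → ℤ // ∑ a, s a = 0}

/-- The point with `s_a` replaced by `s_a + i` and `s_b` by `s_b - i`, for `K = (a, b)`, so that the
`i`-th power of the basic charge preserving shift `T_K` is `(T_K^i f)(s) = f (shift K i s)`. -/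
def shift {N : ℕ} (K : Index N × Index N) (i : ℤ) (s : Charge N) : Charge N :=
  ⟨s.1 + Pi.single K.1 i - Pi.single K.2 i, by
    simp [Finset.sum_sub_distrib, Finset.sum_add_distrib, s.2]⟩

/-- Formal power series in the continuous times, with complex coefficients. -/
abbrev TimeSeries (N : ℕ) : Type := MvPowerSeries (Time N) ℂ

/-- Laurent series in `Λ` whose coefficients are sequences of matrices over the formal power series
in the times; `X j n` is the matrix `X_j(n)`. -/
abbrev FormalShiftSeries (N : ℕ) : Type := ℤ → ℤ → Matrix (Fin N) (Fin N) (TimeSeries N)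

/-- The coefficientwise derivative `∂_{ja} = ∂/∂t_{ja}`. -/
def FormalShiftSeries.deriv {N : ℕ} (x : Time N) (X : FormalShiftSeries N) :
    FormalShiftSeries N :=
  fun j n => (X j n).map (MvPowerSeries.pderiv ℂ x)

/-! ### The factorization problem -/

namespace LaurentAlgebra

variable {N : ℕ} (𝔤 : LaurentAlgebra N)

/-- The ring of `𝔤`-valued formal power series in the continuous times. -/
abbrev Formal : Type := MvPowerSeries (Time N) 𝔤.Elt

/-- The same object written as a Laurent series in `Λ` with coefficients depending on the times. -/
def expand {𝔤 : LaurentAlgebra N} (X : 𝔤.Formal) : FormalShiftSeries N :=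
  fun j n => Matrix.of fun a b α => ((MvPowerSeries.coeff α X : 𝔤.Elt) : ShiftSeries N) j n a b

/-- `A Λ^j`, for a constant matrix `A`, as a constant power series. -/
def formalConst (j : ℤ) (A : Matrix (Fin N) (Fin N) ℂ) : 𝔤.Formal :=
  MvPowerSeries.C (𝔤.const j A)

/-- `exp (∑_{j ≥ 1} t_{ja} Λ^(ε j))`, for `ε = ±1`: expanded in monomials of the times it is
`∑_α (∏_j t_{ja}^{α_j} / α_j !) Λ^(ε ∑_j j α_j)`. -/
def expTimes (a : Index N) (ε : ℤ) : 𝔤.Formal := fun α =>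
  if ∀ x ∈ α.support, x.2 = a then
    𝔤.const (ε * α.sum fun x m => (m : ℤ) * ((x.1 : ℕ) : ℤ))
      ((α.prod fun _ m => ((m.factorial : ℕ) : ℂ))⁻¹ • 1)
  else 0

/-- `W₀ = ∑_k E_{kk} Λ^{s_k} exp (∑_j t_{jk} Λ^j)`. -/
def W₀ (s : Charge N) : 𝔤.Formal :=
  ∑ k : Fin N, 𝔤.formalConst (s.1 (Sum.inl k)) (Matrix.single k k 1) *
    𝔤.expTimes (Sum.inl k) 1

/-- `W̄₀ = ∑_k E_{kk} Λ^{-s_k̄} exp (∑_j t_{jk̄} Λ^{-j})`. -/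
def Wbar₀ (s : Charge N) : 𝔤.Formal :=
  ∑ k : Fin N, 𝔤.formalConst (-s.1 (Sum.inr k)) (Matrix.single k k 1) *
    𝔤.expTimes (Sum.inr k) (-1)

/-- `𝔤₊`-valued power series. -/
def IsPlus {𝔤 : LaurentAlgebra N} (X : 𝔤.Formal) : Prop :=
  ∀ α, ShiftSeries.IsPlus ((MvPowerSeries.coeff α X : 𝔤.Elt) : ShiftSeries N)

/-- `𝔤₋`-valued power series. -/
def IsMinus {𝔤 : LaurentAlgebra N} (X : 𝔤.Formal) : Prop :=
  ∀ α, ShiftSeries.IsMinus ((MvPowerSeries.coeff α X : 𝔤.Elt) : ShiftSeries N)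

/-- `X ∈ G₋`: the invertible operator `X` and its inverse have the form `1 + ∑_{j<0} X_j Λ^j`. -/
def InGMinus {𝔤 : LaurentAlgebra N} (X : 𝔤.Formalˣ) : Prop :=
  IsMinus ((X : 𝔤.Formal) - 1) ∧ IsMinus ((X⁻¹ : 𝔤.Formalˣ) - 1 : 𝔤.Formal)

/-- `X ∈ G₊`: the invertible operator `X` and its inverse have the form `∑_{j≥0} X_j Λ^j`. -/
def InGPlus {𝔤 : LaurentAlgebra N} (X : 𝔤.Formalˣ) : Prop :=
  IsPlus (X : 𝔤.Formal) ∧ IsPlus ((X⁻¹ : 𝔤.Formalˣ) : 𝔤.Formal)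

/-- `S`, `S̄` solve the factorization problem `S(s,t) W₀(s,t) g = S̄(s,t) W̄₀(s,t)`, `S ∈ G₋`,
`S̄ ∈ G₊`, in the zero charge sector. The operator `g ∈ G` does not depend on `s` and `t`. -/
structure IsFactorization (g : 𝔤.Eltˣ) (S Sbar : Charge N → 𝔤.Formalˣ) : Prop where
  minus : ∀ s, InGMinus (S s)
  plus : ∀ s, InGPlus (Sbar s)
  eq : ∀ s, (S s : 𝔤.Formal) * 𝔤.W₀ s * MvPowerSeries.C (g : 𝔤.Elt)
    = (Sbar s : 𝔤.Formal) * 𝔤.Wbar₀ s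

variable {𝔤}

/-- The dressing operator `W = S W₀`. -/
def W (S : Charge N → 𝔤.Formalˣ) (s : Charge N) : 𝔤.Formal := (S s : 𝔤.Formal) * 𝔤.W₀ s

/-- The dressing operator `W̄ = S̄ W̄₀`. -/
def Wbar (Sbar : Charge N → 𝔤.Formalˣ) (s : Charge N) : 𝔤.Formal :=
  (Sbar s : 𝔤.Formal) * 𝔤.Wbar₀ s

/-- The first row `E₁₁ X`, as a Laurent series in `Λ` with coefficients depending on `s, t`. -/
def firstRow [NeZero N] (X : Charge N → 𝔤.Formal) (s : Charge N) : FormalShiftSeries N :=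
  expand (𝔤.formalConst 0 (Matrix.single 0 0 1) * X s)

end LaurentAlgebra

/-! ### Scalar shift operators -/

/-- Scalar functions of the discrete times `s`, the discrete variable `n` and the formal
continuous times. -/
abbrev Scalar (N : ℕ) : Type := Charge N → ℤ → TimeSeries N

/-- Scalar shift operators `P = ∑_{i ∈ ℤ} P_i T_K^i`, for a fixed basic shift `T_K`. -/
abbrev ShiftOp (N : ℕ) : Type := ℤ → Scalar N

namespace ShiftOp

variable {N : ℕ}

/-- The identity operator. -/
def one : ShiftOp N := fun i _ _ => if i = 0 then 1 else 0

/-- The shift operator `T_K` itself. -/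
def T : ShiftOp N := fun i _ _ => if i = 1 then 1 else 0

/-- The composition, `(c T_K^i) ∘ (d T_K^l) = c (T_K^i d) T_K^(i+l)`. It is used for operators
with only finitely many positive powers of `T_K`, where the sum is finite. -/
def comp (K : Index N × Index N) (P Q : ShiftOp N) : ShiftOp N :=
  fun m s n => ∑ᶠ i : ℤ, P i s n * Q (m - i) (shift K i s) n

/-- The powers `P^j`. -/
def pow (K : Index N × Index N) (P : ShiftOp N) : ℕ → ShiftOp N
  | 0 => one
  | j + 1 => comp K (pow K P j) P

/-- The operator `c₀ + c₁ T_K⁻¹ + c₂ T_K⁻² + ⋯`. -/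
def lower (c : ℕ → Scalar N) : ShiftOp N := fun i => if i ≤ 0 then c (-i).toNat else 0

/-- The coefficients of the inverse of `c₀ + c₁ T_K⁻¹ + c₂ T_K⁻² + ⋯`, for invertible `c₀`. -/
def invCoeff (K : Index N × Index N) (c : ℕ → Scalar N) : ℕ → Scalar N
  | m => fun s n => (c 0 s n)⁻¹ * ((if m = 0 then 1 else 0) -
      ∑ i : Fin m, c (i + 1) s n *
        invCoeff K c (m - 1 - i) (shift K (-((i : ℤ) + 1)) s) n)
termination_by m => m
decreasing_by omega

/-- The action `P(X) = ∑_i P_i (T_K^i X)` on `s`-dependent Laurent series in `Λ`, where a scalar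
`P_i` multiplies from the left. It is used for operators `P` with finitely many terms. -/
def act (K : Index N × Index N) (P : ShiftOp N) (X : Charge N → FormalShiftSeries N) :
    Charge N → FormalShiftSeries N :=
  fun s j n => ∑ᶠ i : ℤ, P i s n • X (shift K i s) j n

/-- `∑_{i ≥ 0} P_i T_K^i`. -/
def projGe (P : ShiftOp N) : ShiftOp N := fun i => if 0 ≤ i then P i else 0

/-- `∑_{i > 0} P_i T_K^i`. -/
def projGt (P : ShiftOp N) : ShiftOp N := fun i => if 0 < i then P i else 0

/-- `∑_{i > 0} P_i (T_K^i - 1)`. -/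
def projGtSubOne (P : ShiftOp N) : ShiftOp N := fun i s n =>
  if 0 < i then P i s n
  else if i = 0 then -∑ᶠ l : ℤ, (if 0 < l then P l s n else 0)
  else 0

end ShiftOp

/-! ### Scalar dressing and Lax operators -/

section Lax

variable {N : ℕ} [NeZero N]

/-- The pair `K` with `𝒯_a = T_K`: `𝒯_1 = T_(1,a₀)` and `𝒯_a = T_(a,1)` for `a ≠ 1`. -/
def pair (a₀ a : Index N) : Index N × Index N :=
  if a = Sum.inl 0 then (a, a₀) else (a, Sum.inl 0)

/-- The pair `K` with `𝒯̄_a = T_K`: `𝒯̄_1̄ = T_(1̄,a₀)` and `𝒯̄_a = T_(a,1̄)` for `a ≠ 1̄`. -/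
def pairBar (a₀ a : Index N) : Index N × Index N :=
  if a = Sum.inr 0 then (a, a₀) else (a, Sum.inr 0)

variable {𝔤 : LaurentAlgebra N}

/-- The `(1,k)` entry `φ_{i,1k}` of the coefficients of `S = 1 + φ_1(n) Λ⁻¹ + φ_2(n) Λ⁻² + ⋯`. -/
def phi (S : Charge N → 𝔤.Formalˣ) (i : ℕ) (k : Fin N) : Scalar N :=
  fun s n => LaurentAlgebra.expand (S s : 𝔤.Formal) (-(i : ℤ)) n 0 k

/-- The `(1,k)` entry `φ̄_{i,1k}` of the coefficients of `S̄ = φ̄_0(n) + φ̄_1(n) Λ + ⋯`. -/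
def phiBar (Sbar : Charge N → 𝔤.Formalˣ) (i : ℕ) (k : Fin N) : Scalar N :=
  fun s n => LaurentAlgebra.expand (Sbar s : 𝔤.Formal) (i : ℤ) n 0 k

/-- The coefficients of the scalar dressing operators: `1, φ_{1,11}, φ_{2,11}, …` for `a = 1`,
`φ_{1,1k}, φ_{2,1k}, …` for `a = k ≠ 1`, and `φ̄_{0,1k}, φ̄_{1,1k}, …` for `a = k̄`. -/
def dressingCoeff (S Sbar : Charge N → 𝔤.Formalˣ) : Index N → ℕ → Scalar N
  | Sum.inl k, i => if k = 0 then (if i = 0 then 1 else phi S i 0) else phi S (i + 1) k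
  | Sum.inr k, i => phiBar Sbar i k

/-- The scalar dressing operator `∑_{i ≥ 0} c_i T_K^{-i}` attached to `a`. It is `𝒦_a` for
`K = pair a₀ a` and `𝒦̄_a` for `K = pairBar a₀ a`: the two have the same coefficients. -/
def dressing (S Sbar : Charge N → 𝔤.Formalˣ) (a : Index N) : ShiftOp N :=
  ShiftOp.lower (dressingCoeff S Sbar a)

/-- The inverse of `dressing S Sbar a`, as an operator in powers of `T_K`. -/
def dressingInv (K : Index N × Index N) (S Sbar : Charge N → 𝔤.Formalˣ) (a : Index N) :
    ShiftOp N :=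
  ShiftOp.lower (ShiftOp.invCoeff K (dressingCoeff S Sbar a))

/-- The scalar Lax operator `𝒦 ∘ T_K ∘ 𝒦⁻¹`, which is `ℒ_a` for `K = pair a₀ a` and `ℒ̄_a` for
`K = pairBar a₀ a`. -/
def lax (K : Index N × Index N) (S Sbar : Charge N → 𝔤.Formalˣ) (a : Index N) : ShiftOp N :=
  ShiftOp.comp K (ShiftOp.comp K (dressing S Sbar a) ShiftOp.T) (dressingInv K S Sbar a)

/-- The projection `P ↦ P₊` in the algebra of the shift `𝒯_a`. -/
def proj (a : Index N) (P : ShiftOp N) : ShiftOp N :=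
  if a = Sum.inl 0 then P.projGe else P.projGt

/-- The projection `P ↦ P₊` in the algebra of the shift `𝒯̄_a`. -/
def projBar (a₀ a : Index N) (P : ShiftOp N) : ShiftOp N :=
  if a = Sum.inl 0 then P.projGe
  else if a = Sum.inr 0 ∧ a₀ = Sum.inl 0 then P.projGt
  else P.projGtSubOne

/-- `(ℒ_a^j)₊(X)`. -/
def laxFlow (a₀ : Index N) (S Sbar : Charge N → 𝔤.Formalˣ) (j : ℕ+) (a : Index N)
    (X : Charge N → FormalShiftSeries N) : Charge N → FormalShiftSeries N :=
  ShiftOp.act (pair a₀ a)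
    (proj a (ShiftOp.pow (pair a₀ a) (lax (pair a₀ a) S Sbar a) j)) X

/-- `(ℒ̄_a^j)₊(X)`. -/
def laxFlowBar (a₀ : Index N) (S Sbar : Charge N → 𝔤.Formalˣ) (j : ℕ+) (a : Index N)
    (X : Charge N → FormalShiftSeries N) : Charge N → FormalShiftSeries N :=
  ShiftOp.act (pairBar a₀ a)
    (projBar a₀ a (ShiftOp.pow (pairBar a₀ a) (lax (pairBar a₀ a) S Sbar a) j)) X

end Lax

end Toda

end

noncomputable section

namespace Toda

/-! ### Algebra of scalar shift operators with finitely many positive powers. -/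

section ShiftOperators

variable {N : ℕ}

/-! Uniqueness in the factorization problem turns the flow equations into a check of triangularity.
Let `P` be the projected power of a Lax operator. Passing to another charge multiplies `W₀` and
`Wbar₀` on the left by a diagonal matrix of powers of Λ, and so does the effect of `∂_{ja}` up to a
term containing the derivative of `S` or `Sbar`. Hence the residual `∂_{ja}(E₁₁W) - P(E₁₁W)` has the
form `Y * W₀ s`, the residual for `Wbar` has the form `Ybar * Wbar₀ s`, and `g`, being constant,
carries the first to the second. It follows that `Y S⁻¹ = Ybar Sbar⁻¹`. If `Y` has only negative
powers of Λ and `Ybar` only nonnegative ones, both sides vanish, and so do both residuals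
(`expand_mul_W₀_eq_zero`, `deriv_firstRow_eq_act`).

Triangularity is checked column by column in `dressing_flow`. The entries of column `x` of the first
row are the coefficients of the scalar dressing operator of `x`, and for `T_(a,b)` there are three
kinds of column. In column `a`, the intertwining `L^j K = K T^j` (`pow_conj_comp`) cancels the term
produced by differentiating the bare exponential; the discarded part of `L^j` does not reach the
relevant degrees. In column `b` the shift only lowers the powers that occur, and the one remaining
danger is the coefficient of `T^0` when `b = 1`. In any other column only the leading 1 of column 1
matters, and it contributes the sum of the coefficients of `P`. So the condition is `P_0 = 0` if `b
= 1`, and `P` must annihilate constants if neither `a` nor `b` is 1; this accounts for every form of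
the projection.

The dressing operators are invertible because their leading coefficients have nonzero constant term.
This again follows from factorization, by comparing two neighbouring charges. -/

theorem shift_zero (K : Index N × Index N) (s : Charge N) : shift K 0 s = s := by
  apply Subtype.ext
  simp [shift]

theorem shift_shift (K : Index N × Index N) (i l : ℤ) (s : Charge N) :
    shift K i (shift K l s) = shift K (i + l) s := by
  apply Subtype.ext
  simp only [shift, Pi.single_add]
  abel

namespace ShiftOp

/-- Only the powers `T_K^i` with `i ≤ p` occur in `P`. -/
def DegreeLE (P : ShiftOp N) (p : ℤ) : Prop := ∀ i, p < i → P i = 0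

variable {K : Index N × Index N} {P Q R : ShiftOp N} {p q r : ℤ}

/-- The degree bounds confine the nonzero terms to an interval. Allowing any larger finite set lets
different compositions share one index set. -/
theorem comp_eq_sum (hP : P.DegreeLE p) (hQ : Q.DegreeLE q) {A : Finset ℤ} {m : ℤ}
    (hA : Finset.Icc (m - q) p ⊆ A) (s : Charge N) (n : ℤ) :
    comp K P Q m s n = ∑ i ∈ A, P i s n * Q (m - i) (shift K i s) n := by
  refine finsum_eq_sum_of_support_subset _ fun i hi => hA ?_
  rw [Finset.mem_Icc]
  by_contra h
  apply hi
  rcases lt_or_ge p i with h1 | h1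
  · simp [hP i h1]
  · have h2 : q < m - i := by
      by_contra h2
      exact h ⟨by omega, h1⟩
    simp [hQ _ h2]

theorem DegreeLE.comp (hP : P.DegreeLE p) (hQ : Q.DegreeLE q) :
    (comp K P Q).DegreeLE (p + q) := by
  intro m hm
  funext s n
  rw [comp_eq_sum hP hQ (Finset.Subset.refl _), Finset.Icc_eq_empty (by omega)]
  rfl

theorem comp_assoc (hP : P.DegreeLE p) (hQ : Q.DegreeLE q) (hR : R.DegreeLE r) :
    comp K (comp K P Q) R = comp K P (comp K Q R) := by
  funext m s n
  rw [comp_eq_sum (hP.comp hQ) hR (Finset.Subset.refl _),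
    comp_eq_sum hP (hQ.comp hR) (A := Finset.Icc (m - r - q) p)
      (fun i hi => by simp only [Finset.mem_Icc] at hi ⊢; omega)]
  have h1 : ∀ i ∈ Finset.Icc (m - r) (p + q),
      comp K P Q i s n * R (m - i) (shift K i s) n =
        ∑ l ∈ Finset.Icc (m - r - q) p,
          P l s n * (Q (i - l) (shift K l s) n * R (m - i) (shift K i s) n) := by
    intro i hi
    rw [Finset.mem_Icc] at hi
    rw [comp_eq_sum hP hQ (A := Finset.Icc (m - r - q) p)
      (fun l hl => by simp only [Finset.mem_Icc] at hl ⊢; omega), Finset.sum_mul]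
    exact Finset.sum_congr rfl fun l _ => mul_assoc _ _ _
  rw [Finset.sum_congr rfl h1, Finset.sum_comm]
  refine Finset.sum_congr rfl fun l hl => ?_
  rw [Finset.mem_Icc] at hl
  rw [← Finset.mul_sum, comp_eq_sum hQ hR (A := Finset.Icc (m - r - l) (p + q - l))
    (fun i hi => by simp only [Finset.mem_Icc] at hi ⊢; omega)]
  congr 1
  -- The inner index is measured from `l`, the power already used by `P`.
  refine Finset.sum_bij' (fun i _ => i - l) (fun i _ => i + l) ?_ ?_ ?_ ?_ ?_
  · intro i hi; simp only [Finset.mem_Icc] at hi ⊢; omega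
  · intro i hi; simp only [Finset.mem_Icc] at hi ⊢; omega
  · intro i _; ring
  · intro i _; ring
  · intro i _
    rw [shift_shift, sub_add_cancel, sub_sub_sub_cancel_right]

theorem comp_one (P : ShiftOp N) : comp K P one = P := by
  funext m s n
  rw [comp, finsum_eq_single _ m]
  · simp [one]
  · intro i hi
    have : m - i ≠ 0 := fun h => hi (by omega)
    simp [one, this]

theorem one_comp (P : ShiftOp N) : comp K one P = P := by
  funext m s n
  rw [comp, finsum_eq_single _ 0]
  · simp [one, shift_zero]
  · intro i hi
    simp [one, hi]

theorem comp_T_apply (P : ShiftOp N) (m : ℤ) : comp K P T m = P (m - 1) := by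
  funext s n
  rw [comp, finsum_eq_single _ (m - 1)]
  · simp [T]
  · intro i hi
    have : m - i ≠ 1 := fun h => hi (by omega)
    simp [T, this]

theorem degreeLE_T : (T : ShiftOp N).DegreeLE 1 := by
  intro i hi
  funext s n
  simp [T, hi.ne']

theorem degreeLE_one : (one : ShiftOp N).DegreeLE 0 := by
  intro i hi
  funext s n
  simp [one, hi.ne']

theorem degreeLE_lower (c : ℕ → Scalar N) : (lower c).DegreeLE 0 := by
  intro i hi
  simp [lower, hi.not_ge]

theorem lower_neg (c : ℕ → Scalar N) (i : ℕ) : lower c (-(i : ℤ)) = c i := by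
  simp [lower]

theorem lower_zero (c : ℕ → Scalar N) : lower c 0 = c 0 := by
  simp [lower]

theorem invCoeff_zero (c : ℕ → Scalar N) (s : Charge N) (n : ℤ) :
    invCoeff K c 0 s n = (c 0 s n)⁻¹ := by
  rw [invCoeff]
  simp

/-- Isolating the term of index 0 in each coefficient of the product leaves exactly the recursion
that defines `invCoeff`. -/
theorem comp_lower_invCoeff {c : ℕ → Scalar N}
    (hc : ∀ s n, MvPowerSeries.constantCoeff (c 0 s n) ≠ 0) :
    comp K (lower c) (lower (invCoeff K c)) = one := by
  funext m s n
  rcases lt_or_ge 0 m with hm | hm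
  · rw [((degreeLE_lower c).comp (degreeLE_lower _)) m (by simpa using hm), degreeLE_one m hm]
  obtain ⟨k, rfl⟩ : ∃ k : ℕ, m = -(k : ℤ) := ⟨(-m).toNat, by omega⟩
  have key : c 0 s n * invCoeff K c k s n = (if k = 0 then 1 else 0) -
      ∑ i : Fin k, c (i + 1) s n *
        invCoeff K c (k - 1 - i) (shift K (-((i : ℤ) + 1)) s) n := by
    conv_lhs => rw [invCoeff]
    rw [← mul_assoc, MvPowerSeries.mul_inv_cancel _ (hc s n), one_mul]
  rw [comp_eq_sum (degreeLE_lower c) (degreeLE_lower _)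
    (A := (Finset.range (k + 1)).image fun i : ℕ => -(i : ℤ))
    (fun i hi => by
      simp only [Finset.mem_Icc] at hi
      simp only [Finset.mem_image, Finset.mem_range]
      exact ⟨(-i).toNat, by omega, by omega⟩),
    Finset.sum_image (fun a _ b _ h => by simpa using h), Finset.sum_range_succ']
  simp only [Nat.cast_zero, neg_zero, shift_zero, lower_zero, sub_zero, lower_neg]
  rw [key, Finset.sum_fin_eq_sum_range]
  have hsum : ∀ i ∈ Finset.range k, c (i + 1) s n *
      lower (invCoeff K c) (-(k : ℤ) - -((i + 1 : ℕ) : ℤ)) (shift K (-((i + 1 : ℕ) : ℤ)) s) n =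
        if h : i < k then
          c (i + 1) s n * invCoeff K c (k - 1 - i) (shift K (-((i : ℤ) + 1)) s) n
        else 0 := by
    intro i hi
    rw [Finset.mem_range] at hi
    rw [dif_pos hi]
    have : -(k : ℤ) - -((i + 1 : ℕ) : ℤ) = -((k - 1 - i : ℕ) : ℤ) := by omega
    rw [this, lower_neg]
    simp
  rw [Finset.sum_congr rfl hsum, add_sub_cancel]
  simp [one]

/-- The right inverse has an invertible leading coefficient, so it has a right inverse of its own;
by associativity that one is the original operator. -/
theorem comp_invCoeff_lower {c : ℕ → Scalar N}
    (hc : ∀ s n, MvPowerSeries.constantCoeff (c 0 s n) ≠ 0) :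
    comp K (lower (invCoeff K c)) (lower c) = one := by
  have h1 := comp_lower_invCoeff (K := K) hc
  have hd : ∀ s n, MvPowerSeries.constantCoeff (invCoeff K c 0 s n) ≠ 0 := by
    intro s n h
    have h2 := congrArg MvPowerSeries.constantCoeff (MvPowerSeries.mul_inv_cancel _ (hc s n))
    rw [← invCoeff_zero (K := K), map_mul, h] at h2
    simp at h2
  have h2 := comp_lower_invCoeff (K := K) hd
  have h3 : lower (invCoeff K (invCoeff K c)) = lower c := by
    rw [← one_comp (K := K) (lower (invCoeff K (invCoeff K c))), ← h1,
      comp_assoc (degreeLE_lower _) (degreeLE_lower _) (degreeLE_lower _), h2, comp_one]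
  rw [h3] at h2
  exact h2

theorem DegreeLE.pow (hP : P.DegreeLE 1) : ∀ j : ℕ, (pow K P j).DegreeLE j
  | 0 => degreeLE_one
  | j + 1 => by
    rw [Nat.cast_succ]
    exact (hP.pow j).comp hP

/-- If `L = P T Q` with `Q P = 1`, then `L^j P = P T^j`. -/
theorem pow_conj_comp (hP : P.DegreeLE 0) (hQ : Q.DegreeLE 0) (h : comp K Q P = one) (j : ℕ)
    (m : ℤ) : comp K (pow K (comp K (comp K P T) Q) j) P m = P (m - j) := by
  have hL : (comp K (comp K P T) Q).DegreeLE 1 := by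
    simpa using (hP.comp degreeLE_T).comp hQ
  induction j generalizing m with
  | zero => simp [pow, one_comp]
  | succ j ih =>
    rw [pow, comp_assoc (hL.pow j) hL hP, comp_assoc (hP.comp degreeLE_T) hQ hP, h, comp_one,
      ← comp_assoc (hL.pow j) hP degreeLE_T, comp_T_apply, ih, Nat.cast_succ]
    congr 1
    ring

end ShiftOp

end ShiftOperators

/-- Leibniz rule for power series over a noncommutative ring. -/
theorem pderivFun_mul {σ A : Type*} [Ring A] (x : σ) (f g : MvPowerSeries σ A) :
    (f * g).pderivFun x = f.pderivFun x * g + f * g.pderivFun x := by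
  classical
  -- Differentiation weights a coefficient by its exponent at `x`; this is the corresponding index
  -- shift in the Cauchy product, stated for the first factor and reused for the second by symmetry.
  have key : ∀ (n : σ →₀ ℕ) (F : (σ →₀ ℕ) → (σ →₀ ℕ) → A),
      ∑ p ∈ Finset.HasAntidiagonal.antidiagonal n, F (p.1 + Finsupp.single x 1) p.2 * ((p.1 x : A) + 1) =
        ∑ p ∈ Finset.HasAntidiagonal.antidiagonal (n + Finsupp.single x 1), F p.1 p.2 * (p.1 x : A) := by
    intro n F
    refine Finset.sum_of_injOn (fun p => (p.1 + Finsupp.single x 1, p.2)) ?_ ?_ ?_ ?_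
    · rintro ⟨a, b⟩ _ ⟨c, d⟩ _ h
      simpa using h
    · rintro ⟨a, b⟩ h
      simp only [Finset.mem_coe,
        Finset.HasAntidiagonal.mem_antidiagonal] at h ⊢
      rw [← h]; abel
    -- A pair outside the image of the shift has exponent 0 at `x`, hence weight 0.
    · rintro ⟨a, b⟩ h h'
      have hx : a x = 0 := by
        by_contra hx
        apply h'
        have ha : a - Finsupp.single x 1 + Finsupp.single x 1 = a :=
          tsub_add_cancel_of_le (Finsupp.single_le_iff.2 (Nat.one_le_iff_ne_zero.2 hx))
        refine ⟨(a - Finsupp.single x 1, b), ?_, by simp [ha]⟩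
        simp only [Finset.mem_coe,
          Finset.HasAntidiagonal.mem_antidiagonal] at h ⊢
        apply add_right_cancel (b := Finsupp.single x 1)
        rw [← h, add_right_comm, ha]
      simp [hx]
    · rintro ⟨a, b⟩ _
      simp
  ext n
  rw [MvPowerSeries.coeff_pderivFun, map_add, MvPowerSeries.coeff_mul, MvPowerSeries.coeff_mul,
    MvPowerSeries.coeff_mul]
  have h1 := key n fun p q => MvPowerSeries.coeff p f * MvPowerSeries.coeff q g
  have swap : ∀ (n : σ →₀ ℕ) (G : (σ →₀ ℕ) × (σ →₀ ℕ) → A),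
      ∑ p ∈ Finset.HasAntidiagonal.antidiagonal n, G p =
        ∑ p ∈ Finset.HasAntidiagonal.antidiagonal n, G p.swap := fun n G =>
    Finset.sum_equiv (Equiv.prodComm _ _) (by simp [add_comm]) (by simp)
  have h2 : ∑ p ∈ Finset.HasAntidiagonal.antidiagonal n, MvPowerSeries.coeff p.1 f *
      MvPowerSeries.coeff (p.2 + Finsupp.single x 1) g * ((p.2 x : A) + 1) =
      ∑ p ∈ Finset.HasAntidiagonal.antidiagonal (n + Finsupp.single x 1),
        MvPowerSeries.coeff p.1 f * MvPowerSeries.coeff p.2 g * (p.2 x : A) := by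
    rw [swap n, swap (n + _)]
    exact key n fun p q => MvPowerSeries.coeff q f * MvPowerSeries.coeff p g
  have h3 : ∀ p ∈ Finset.HasAntidiagonal.antidiagonal n, MvPowerSeries.coeff p.1 (f.pderivFun x) *
      MvPowerSeries.coeff p.2 g = MvPowerSeries.coeff (p.1 + Finsupp.single x 1) f *
        MvPowerSeries.coeff p.2 g * ((p.1 x : A) + 1) := by
    intro p _
    rw [MvPowerSeries.coeff_pderivFun, mul_assoc, mul_assoc]
    exact congrArg _ ((Nat.cast_commute _ _).add_left (Commute.one_left _)).eq
  have h4 : ∀ p ∈ Finset.HasAntidiagonal.antidiagonal n, MvPowerSeries.coeff p.1 f *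
      MvPowerSeries.coeff p.2 (g.pderivFun x) = MvPowerSeries.coeff p.1 f *
        MvPowerSeries.coeff (p.2 + Finsupp.single x 1) g * ((p.2 x : A) + 1) := by
    intro p _
    rw [MvPowerSeries.coeff_pderivFun, mul_assoc]
  rw [Finset.sum_congr rfl h3, Finset.sum_congr rfl h4, h1, h2, ← Finset.sum_add_distrib,
    Finset.sum_mul]
  refine Finset.sum_congr rfl fun p hp => ?_
  rw [← mul_add, ← Nat.cast_add, ← Finsupp.add_apply, Finset.HasAntidiagonal.mem_antidiagonal.1 hp]
  simp

/-! ### Constant operators and the coefficients of formal operators. -/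

namespace LaurentAlgebra

variable {N : ℕ} {𝔤 : LaurentAlgebra N}

theorem const_mul_const (i j : ℤ) (A B : Matrix (Fin N) (Fin N) ℂ) :
    𝔤.const i A * 𝔤.const j B = 𝔤.const (i + j) (A * B) := by
  apply Subtype.ext
  funext m n
  rw [mul_apply, tsum_eq_single i]
  · by_cases h : m = i + j
    · subst h
      simp [const, ShiftSeries.monomial]
    · have : m - i ≠ j := fun h' => h (by omega)
      simp [const, ShiftSeries.monomial, h, this]
  · intro l hl
    simp [const, ShiftSeries.monomial, hl]

theorem const_add (j : ℤ) (A B : Matrix (Fin N) (Fin N) ℂ) :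
    𝔤.const j (A + B) = 𝔤.const j A + 𝔤.const j B :=
  Subtype.ext (Pi.single_add (f := fun _ => ℤ → Matrix (Fin N) (Fin N) ℂ) j (fun _ => A) fun _ => B)

theorem const_zero (j : ℤ) : 𝔤.const j 0 = 0 :=
  Subtype.ext (Pi.single_zero (M := fun _ => ℤ → Matrix (Fin N) (Fin N) ℂ) j)

theorem const_smul (j : ℤ) (c : ℂ) (A : Matrix (Fin N) (Fin N) ℂ) :
    𝔤.const j (c • A) = c • 𝔤.const j A :=
  Subtype.ext (Pi.single_smul (f := fun _ => ℤ → Matrix (Fin N) (Fin N) ℂ) j c fun _ => A)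

theorem const_zero_one : 𝔤.const 0 1 = 1 := rfl

theorem formalConst_mul_formalConst (i j : ℤ) (A B : Matrix (Fin N) (Fin N) ℂ) :
    𝔤.formalConst i A * 𝔤.formalConst j B = 𝔤.formalConst (i + j) (A * B) := by
  rw [formalConst, formalConst, ← map_mul, const_mul_const, formalConst]

theorem formalConst_zero (j : ℤ) : 𝔤.formalConst j 0 = 0 := by
  rw [formalConst, const_zero, map_zero]

theorem formalConst_zero_one : 𝔤.formalConst 0 1 = 1 := by
  rw [formalConst, const_zero_one, map_one]

/-! ### Coefficients of `𝔤`-valued power series -/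

theorem expand_add (X Y : 𝔤.Formal) : expand (X + Y) = expand X + expand Y := rfl

theorem expand_sub (X Y : 𝔤.Formal) : expand (X - Y) = expand X - expand Y := rfl

theorem expand_zero : expand (0 : 𝔤.Formal) = 0 := rfl

theorem expand_sum {ι : Type*} (A : Finset ι) (X : ι → 𝔤.Formal) :
    expand (∑ i ∈ A, X i) = ∑ i ∈ A, expand (X i) :=
  map_sum (⟨⟨expand, expand_zero⟩, expand_add⟩ : 𝔤.Formal →+ FormalShiftSeries N) X A

theorem coeff_expand (X : 𝔤.Formal) (j n : ℤ) (a b : Fin N) (α : Time N →₀ ℕ) :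
    MvPowerSeries.coeff α (expand X j n a b) =
      ((MvPowerSeries.coeff α X : 𝔤.Elt) : ShiftSeries N) j n a b := rfl

theorem isPlus_iff {X : 𝔤.Formal} : IsPlus X ↔ ∀ j < 0, ∀ n, expand X j n = 0 :=
  ⟨fun h j hj n => by
      ext a b α
      rw [coeff_expand, h α j hj n]
      rfl,
    fun h α j hj n => by
      ext a b
      rw [← coeff_expand, h j hj n]
      rfl⟩

theorem isMinus_iff {X : 𝔤.Formal} : IsMinus X ↔ ∀ j, 0 ≤ j → ∀ n, expand X j n = 0 :=
  ⟨fun h j hj n => by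
      ext a b α
      rw [coeff_expand, h α j hj n]
      rfl,
    fun h α j hj n => by
      ext a b
      rw [← coeff_expand, h j hj n]
      rfl⟩

/-- A coefficient of a product to which a single pair of coefficients contributes. -/
theorem expand_mul_eq_single {X Y : 𝔤.Formal} {m n : ℤ} (p : ℤ)
    (h : ∀ i, i ≠ p → expand X i n = 0 ∨ expand Y (m - i) (n + i) = 0) :
    expand (X * Y) m n = expand X p n * expand Y (m - p) (n + p) := by
  classical
  ext a b α
  rw [coeff_expand, MvPowerSeries.coeff_mul, Matrix.mul_apply, map_sum]
  simp only [MvPowerSeries.coeff_mul, coeff_expand]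
  rw [Finset.sum_comm]
  refine (map_sum (⟨⟨fun Z => (Z : ShiftSeries N) m n a b, rfl⟩, fun _ _ => rfl⟩ : 𝔤.Elt →+ ℂ)
    _ _).trans (Finset.sum_congr rfl fun q _ => ?_)
  change ((_ * _ : 𝔤.Elt) : ShiftSeries N) m n a b = _
  rw [mul_apply, tsum_eq_single p, Matrix.mul_apply]
  intro i hi
  rcases h i hi with h | h
  · have : ((MvPowerSeries.coeff q.1 X : 𝔤.Elt) : ShiftSeries N) i n = 0 := by
      ext a b
      rw [← coeff_expand, h]
      rfl
    rw [this, zero_mul]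
  · have : ((MvPowerSeries.coeff q.2 Y : 𝔤.Elt) : ShiftSeries N) (m - i) (n + i) = 0 := by
      ext a b
      rw [← coeff_expand, h]
      rfl
    rw [this, mul_zero]

theorem expand_mul_eq_zero {X : 𝔤.Formal} {n : ℤ} (h : ∀ i, expand X i n = 0) (Y : 𝔤.Formal)
    (m : ℤ) : expand (X * Y) m n = 0 := by
  rw [expand_mul_eq_single 0 fun i _ => Or.inl (h i), h, zero_mul]

theorem expand_formalConst (j : ℤ) (A : Matrix (Fin N) (Fin N) ℂ) (i n : ℤ) :
    expand (𝔤.formalConst j A) i n = if i = j then A.map MvPowerSeries.C else 0 := by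
  classical
  ext a b α
  rw [coeff_expand, formalConst, MvPowerSeries.coeff_C]
  by_cases hα : α = 0
  · by_cases hi : i = j
    · simp [hα, hi, const, ShiftSeries.monomial]
    · simp [hα, hi, const, ShiftSeries.monomial]
  · by_cases hi : i = j
    · simp [hα, hi, MvPowerSeries.coeff_C]
    · simp [hα, hi]

theorem expand_one (i n : ℤ) : expand (1 : 𝔤.Formal) i n = if i = 0 then 1 else 0 := by
  rw [← formalConst_zero_one, expand_formalConst]
  simp

theorem expand_formalConst_mul (j : ℤ) (A : Matrix (Fin N) (Fin N) ℂ) (X : 𝔤.Formal) (m n : ℤ) :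
    expand (𝔤.formalConst j A * X) m n = A.map MvPowerSeries.C * expand X (m - j) (n + j) := by
  rw [expand_mul_eq_single j, expand_formalConst, if_pos rfl]
  intro i hi
  rw [expand_formalConst, if_neg hi]
  exact Or.inl rfl

theorem expand_mul_formalConst (X : 𝔤.Formal) (j : ℤ) (A : Matrix (Fin N) (Fin N) ℂ) (m n : ℤ) :
    expand (X * 𝔤.formalConst j A) m n = expand X (m - j) n * A.map MvPowerSeries.C := by
  rw [expand_mul_eq_single (m - j), expand_formalConst, if_pos (by ring)]
  intro i hi
  rw [expand_formalConst, if_neg fun h => hi (by omega)]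
  exact Or.inr rfl

/-- Both derivatives multiply coefficients by the same natural number, so the one over the
noncommutative ring `𝔤.Elt` agrees with the entrywise one over ℂ. -/
theorem expand_pderivFun (x : Time N) (X : 𝔤.Formal) :
    expand (X.pderivFun x) = (expand X).deriv x := by
  funext j n
  ext a b α
  rw [coeff_expand, FormalShiftSeries.deriv, Matrix.map_apply, MvPowerSeries.coeff_pderiv,
    coeff_expand, MvPowerSeries.coeff_pderivFun, ← Nat.cast_succ, ← Nat.cast_succ,
    ← nsmul_eq_mul', ← nsmul_eq_mul', Submodule.coe_smul_of_tower]
  rfl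

/-- A scalar power series as a `𝔤`-valued power series. -/
def scalar (c : TimeSeries N) : 𝔤.Formal := fun α => MvPowerSeries.coeff α c • (1 : 𝔤.Elt)

theorem expand_scalar_mul (c : TimeSeries N) (X : 𝔤.Formal) (m n : ℤ) :
    expand (scalar c * X) m n = c • expand X m n := by
  have h : ∀ i, expand (scalar c : 𝔤.Formal) i n = if i = 0 then c • 1 else 0 := by
    intro i
    ext a b α
    have h0 : MvPowerSeries.coeff α (scalar c : 𝔤.Formal) =
      MvPowerSeries.coeff α c • (1 : 𝔤.Elt) := rfl
    rw [coeff_expand, h0, Submodule.coe_smul_of_tower, coe_one]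
    by_cases hi : i = 0
    · by_cases hab : a = b
      · simp [hi, hab, ShiftSeries.monomial]
      · simp [hi, hab, ShiftSeries.monomial]
    · simp [hi, ShiftSeries.monomial]
  rw [expand_mul_eq_single 0, h, if_pos rfl, sub_zero, add_zero, smul_mul_assoc, one_mul]
  intro i hi
  rw [h, if_neg hi]
  exact Or.inl rfl

/-! ### Bare dressing operators -/

/-- `∑_k E_{kk} Λ^{d_k}`. -/
def diag (d : Fin N → ℤ) : 𝔤.Formal := ∑ k, 𝔤.formalConst (d k) (Matrix.single k k 1)

theorem diag_mul_formalConst_single (d : Fin N → ℤ) (i : ℤ) (k : Fin N) :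
    (diag d : 𝔤.Formal) * 𝔤.formalConst i (Matrix.single k k 1) =
      𝔤.formalConst (d k + i) (Matrix.single k k 1) := by
  rw [diag, Finset.sum_mul, Finset.sum_eq_single k]
  · rw [formalConst_mul_formalConst, Matrix.single_mul_single_same, one_mul]
  · intro l _ hl
    rw [formalConst_mul_formalConst, Matrix.single_mul_single_of_ne _ _ _ _ hl, formalConst_zero]
  · simp

theorem diag_zero : (diag 0 : 𝔤.Formal) = 1 := by
  rw [← formalConst_zero_one, ← Matrix.sum_single_one]
  simp only [diag, formalConst, ← map_sum]
  congr 1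
  exact (map_sum (⟨⟨𝔤.const 0, const_zero 0⟩, const_add 0⟩ :
    Matrix (Fin N) (Fin N) ℂ →+ 𝔤.Elt) _ _).symm

theorem diag_mul_diag (d e : Fin N → ℤ) : (diag d * diag e : 𝔤.Formal) = diag (d + e) := by
  conv_lhs => rw [diag.eq_1 e, Finset.mul_sum]
  exact Finset.sum_congr rfl fun k _ => diag_mul_formalConst_single d (e k) k

/-- This is how a change of charge becomes a shift of the exponent, by a different amount in each
column. -/
theorem expand_mul_diag (X : 𝔤.Formal) (d : Fin N → ℤ) (m n : ℤ) (a k : Fin N) :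
    expand (X * diag d) m n a k = expand X (m - d k) n a k := by
  rw [diag, Finset.mul_sum, expand_sum, Finset.sum_apply, Finset.sum_apply, Matrix.sum_apply,
    Finset.sum_eq_single k]
  · rw [expand_mul_formalConst, Matrix.map_single]
    simp
  · intro l _ hl
    rw [expand_mul_formalConst, Matrix.map_single,
      Matrix.mul_single_apply_of_ne _ _ _ _ _ hl.symm]
  · simp

/-- `∑_k E_{kk} Λ^{d_k} exp (∑_j t_{j,e(k)} Λ^{ε j})`. -/
def vacuum (e : Fin N → Index N) (ε : ℤ) (d : Fin N → ℤ) : 𝔤.Formal :=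
  ∑ k, 𝔤.formalConst (d k) (Matrix.single k k 1) * 𝔤.expTimes (e k) ε

theorem vacuum_add (e : Fin N → Index N) (ε : ℤ) (d d' : Fin N → ℤ) :
    (vacuum e ε (d + d') : 𝔤.Formal) = diag d * vacuum e ε d' := by
  rw [vacuum, vacuum, Finset.mul_sum]
  refine Finset.sum_congr rfl fun k _ => ?_
  rw [← _root_.mul_assoc, diag_mul_formalConst_single]
  rfl

theorem constantCoeff_vacuum (e : Fin N → Index N) (ε : ℤ) (d : Fin N → ℤ) :
    MvPowerSeries.constantCoeff (vacuum e ε d : 𝔤.Formal) =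
      MvPowerSeries.constantCoeff (diag d : 𝔤.Formal) := by
  have h : ∀ a, MvPowerSeries.constantCoeff (𝔤.expTimes a ε) = 1 := by
    intro a
    change 𝔤.expTimes a ε 0 = 1
    simp [expTimes, const_zero_one]
  simp only [vacuum, diag, map_sum, map_mul, h, mul_one]

/-- The constant term of the bare operator is `diag d`, with inverse `diag (-d)`, so the bare
operator has a right inverse as a power series. -/
theorem mul_vacuum_right_cancel {e : Fin N → Index N} {ε : ℤ} {d : Fin N → ℤ} {X Y : 𝔤.Formal}
    (h : X * vacuum e ε d = Y * vacuum e ε d) : X = Y := by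
  let u : 𝔤.Eltˣ := ⟨MvPowerSeries.constantCoeff (diag d : 𝔤.Formal),
    MvPowerSeries.constantCoeff (diag (-d) : 𝔤.Formal),
    by rw [← map_mul, diag_mul_diag, add_neg_cancel, diag_zero, map_one],
    by rw [← map_mul, diag_mul_diag, neg_add_cancel, diag_zero, map_one]⟩
  have hu := MvPowerSeries.mul_invOfUnit (vacuum e ε d : 𝔤.Formal) u (constantCoeff_vacuum e ε d)
  rw [← mul_one X, ← mul_one Y, ← hu, ← _root_.mul_assoc, h, _root_.mul_assoc]

theorem pderivFun_formalConst_mul (x : Time N) (j : ℤ) (A : Matrix (Fin N) (Fin N) ℂ)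
    (X : 𝔤.Formal) : (𝔤.formalConst j A * X).pderivFun x = 𝔤.formalConst j A * X.pderivFun x := by
  rw [pderivFun_mul, formalConst, MvPowerSeries.pderivFun_C, zero_mul, zero_add]

theorem pderivFun_expTimes_self (j : ℕ+) (a : Index N) (ε : ℤ) :
    (𝔤.expTimes a ε).pderivFun (j, a) = 𝔤.formalConst (ε * j) 1 * 𝔤.expTimes a ε := by
  classical
  ext1 α
  rw [MvPowerSeries.coeff_pderivFun, formalConst, MvPowerSeries.coeff_C_mul,
    MvPowerSeries.coeff_apply, MvPowerSeries.coeff_apply, expTimes, expTimes]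
  have hs : (∀ x ∈ (α + Finsupp.single (j, a) 1).support, x.2 = a) ↔
      ∀ x ∈ α.support, x.2 = a := by
    refine ⟨fun h x hx => h x ?_, fun h x hx => ?_⟩
    · rw [Finsupp.mem_support_iff] at hx ⊢
      simp [hx]
    · by_cases hxj : x = (j, a)
      · rw [hxj]
      · refine h x ?_
        rw [Finsupp.mem_support_iff] at hx ⊢
        simpa [Finsupp.single_apply, Ne.symm hxj] using hx
  by_cases hα : ∀ x ∈ α.support, x.2 = a
  · rw [if_pos (hs.2 hα), if_pos hα, const_mul_const, one_mul,
      Finsupp.sum_add_index' (by simp) (fun x m l => by push_cast; ring),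
      Finsupp.sum_single_index (by simp)]
    -- The factor `α (j, a) + 1` brought down by differentiation cancels against the growth of the
    -- factorial.
    have hp : (α + Finsupp.single (j, a) 1).prod (fun _ m => ((m.factorial : ℕ) : ℂ)) =
        (α (j, a) + 1) * α.prod fun _ m => ((m.factorial : ℕ) : ℂ) := by
      rw [← Finsupp.mul_prod_erase' _ (j, a) _ (by simp),
        ← Finsupp.mul_prod_erase' α (j, a) _ (by simp), Finsupp.erase_add,
        Finsupp.erase_single, add_zero, Finsupp.add_apply, Finsupp.single_eq_same,
        Nat.factorial_succ]
      push_cast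
      ring
    have hm : ∀ Z : 𝔤.Elt, Z * ((α (j, a) : 𝔤.Elt) + 1) = ((α (j, a) : ℂ) + 1) • Z := by
      intro Z
      rw [← Nat.cast_succ, ← nsmul_eq_mul', ← Nat.cast_smul_eq_nsmul ℂ, Nat.cast_succ]
    rw [hp, hm, const_smul, const_smul, smul_smul, mul_inv,
      mul_inv_cancel_left₀ (Nat.cast_add_one_ne_zero _)]
    congr 2
    push_cast
    ring
  · rw [if_neg (mt hs.1 hα), if_neg hα, zero_mul, mul_zero]

theorem pderivFun_expTimes_of_ne {j : ℕ+} {a b : Index N} (h : b ≠ a) (ε : ℤ) :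
    (𝔤.expTimes a ε).pderivFun (j, b) = 0 := by
  ext1 α
  rw [MvPowerSeries.coeff_pderivFun, MvPowerSeries.coeff_apply, expTimes, if_neg]
  · rw [zero_mul, map_zero]
  · intro h'
    exact h (h' (j, b) (by simp))

theorem pderivFun_sum {σ A ι : Type*} [Ring A] (x : σ) (B : Finset ι)
    (f : ι → MvPowerSeries σ A) :
    (∑ i ∈ B, f i).pderivFun x = ∑ i ∈ B, (f i).pderivFun x :=
  map_sum (⟨⟨MvPowerSeries.pderivFun x, by
    simpa using MvPowerSeries.pderivFun_C (0 : A)⟩, MvPowerSeries.pderivFun_add⟩ :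
    MvPowerSeries σ A →+ MvPowerSeries σ A) f B

theorem pderivFun_vacuum {e : Fin N → Index N} (he : Function.Injective e) (ε : ℤ)
    (d : Fin N → ℤ) (j : ℕ+) (k : Fin N) :
    (vacuum e ε d : 𝔤.Formal).pderivFun (j, e k) =
      𝔤.formalConst (ε * j) (Matrix.single k k 1) * vacuum e ε d := by
  rw [vacuum, pderivFun_sum, Finset.mul_sum]
  refine Finset.sum_congr rfl fun l _ => ?_
  rw [pderivFun_formalConst_mul, ← _root_.mul_assoc, formalConst_mul_formalConst]
  rcases eq_or_ne k l with rfl | h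
  · rw [pderivFun_expTimes_self, ← _root_.mul_assoc, formalConst_mul_formalConst, mul_one,
      Matrix.single_mul_single_same, one_mul, add_comm]
  · rw [pderivFun_expTimes_of_ne (he.ne h), mul_zero, Matrix.single_mul_single_of_ne _ _ _ _ h,
      formalConst_zero, zero_mul]

theorem pderivFun_vacuum_of_notMem {e : Fin N → Index N} {a : Index N} (ha : ∀ k, a ≠ e k) (ε : ℤ)
    (d : Fin N → ℤ) (j : ℕ+) : (vacuum e ε d : 𝔤.Formal).pderivFun (j, a) = 0 := by
  rw [vacuum, pderivFun_sum]
  refine Finset.sum_eq_zero fun l _ => ?_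
  rw [pderivFun_formalConst_mul, pderivFun_expTimes_of_ne (ha l), mul_zero]

theorem W₀_eq_vacuum (s : Charge N) : 𝔤.W₀ s = vacuum Sum.inl 1 fun k => s.1 (Sum.inl k) := rfl

theorem Wbar₀_eq_vacuum (s : Charge N) :
    𝔤.Wbar₀ s = vacuum Sum.inr (-1) fun k => -s.1 (Sum.inr k) := rfl

/-- All charges thereby share one right factor `𝔤.W₀ s`, which allows rows at different charges to
be combined. -/
theorem W₀_eq_diag_mul (s s' : Charge N) :
    𝔤.W₀ s' = diag (fun k => s'.1 (Sum.inl k) - s.1 (Sum.inl k)) * 𝔤.W₀ s := by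
  rw [W₀_eq_vacuum, W₀_eq_vacuum, ← vacuum_add]
  congr 1
  funext k
  simp

theorem Wbar₀_eq_diag_mul (s s' : Charge N) :
    𝔤.Wbar₀ s' = diag (fun k => s.1 (Sum.inr k) - s'.1 (Sum.inr k)) * 𝔤.Wbar₀ s := by
  rw [Wbar₀_eq_vacuum, Wbar₀_eq_vacuum, ← vacuum_add]
  congr 1
  funext k
  simp only [Pi.add_apply]
  ring

/-- `F` is `E_{ll} Λ^j` when `a` is the unbarred index `l`, and 0 when `a` is barred. Only its
effect under right multiplication is needed later. -/
theorem exists_pderivFun_W₀ (j : ℕ+) (a : Index N) (s : Charge N) :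
    ∃ F : 𝔤.Formal, (𝔤.W₀ s).pderivFun (j, a) = F * 𝔤.W₀ s ∧
      ∀ (X : 𝔤.Formal) (m n : ℤ) (b k : Fin N),
        expand (X * F) m n b k = if Sum.inl k = a then expand X (m - j) n b k else 0 := by
  rcases a with l | l
  · refine ⟨_, pderivFun_vacuum Sum.inl_injective 1 _ j l, fun X m n b k => ?_⟩
    rw [expand_mul_formalConst, Matrix.map_single, one_mul, map_one]
    by_cases h : k = l
    · subst h
      simp
    · rw [Matrix.mul_single_apply_of_ne _ _ _ _ _ h, if_neg (by simpa using h)]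
  · refine ⟨0, ?_, fun X m n b k => ?_⟩
    · rw [zero_mul]
      exact pderivFun_vacuum_of_notMem (by simp) _ _ _
    · simp [expand_zero]

theorem exists_pderivFun_Wbar₀ (j : ℕ+) (a : Index N) (s : Charge N) :
    ∃ F : 𝔤.Formal, (𝔤.Wbar₀ s).pderivFun (j, a) = F * 𝔤.Wbar₀ s ∧
      ∀ (X : 𝔤.Formal) (m n : ℤ) (b k : Fin N),
        expand (X * F) m n b k = if Sum.inr k = a then expand X (m + j) n b k else 0 := by
  rcases a with l | l
  · refine ⟨0, ?_, fun X m n b k => ?_⟩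
    · rw [zero_mul]
      exact pderivFun_vacuum_of_notMem (by simp) _ _ _
    · simp [expand_zero]
  · refine ⟨_, pderivFun_vacuum Sum.inr_injective (-1) _ j l, fun X m n b k => ?_⟩
    rw [expand_mul_formalConst, Matrix.map_single, neg_one_mul, sub_neg_eq_add, map_one]
    by_cases h : k = l
    · subst h
      simp
    · rw [Matrix.mul_single_apply_of_ne _ _ _ _ _ h, if_neg (by simpa using h)]

/-! ### Triangular factors -/

theorem InGMinus.expand_eq {X : 𝔤.Formalˣ} (hX : InGMinus X) {i : ℤ} (hi : 0 ≤ i) (n : ℤ) :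
    expand (X : 𝔤.Formal) i n = if i = 0 then 1 else 0 := by
  have h := isMinus_iff.1 hX.1 i hi n
  rw [expand_sub, Pi.sub_apply, Pi.sub_apply, expand_one] at h
  exact sub_eq_zero.1 h

theorem InGMinus.expand_inv_eq {X : 𝔤.Formalˣ} (hX : InGMinus X) {i : ℤ} (hi : 0 ≤ i) (n : ℤ) :
    expand ((X⁻¹ : 𝔤.Formalˣ) : 𝔤.Formal) i n = if i = 0 then 1 else 0 := by
  have h := isMinus_iff.1 hX.2 i hi n
  rw [expand_sub, Pi.sub_apply, Pi.sub_apply, expand_one] at h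
  exact sub_eq_zero.1 h

theorem InGPlus.expand_eq_zero {X : 𝔤.Formalˣ} (hX : InGPlus X) {i : ℤ} (hi : i < 0) (n : ℤ) :
    expand (X : 𝔤.Formal) i n = 0 := isPlus_iff.1 hX.1 i hi n

/-- Since `V⁻¹` is 1 plus lower terms, it does not alter coefficients from the top degree upwards.
The left factor is always evaluated at the same `n`, so the degree bound may be assumed for that `n`
alone. -/
theorem InGMinus.expand_mul_inv {V : 𝔤.Formalˣ} (hV : InGMinus V) {X : 𝔤.Formal} {n p : ℤ}
    (hX : ∀ i, p < i → expand X i n = 0) {m : ℤ} (hm : p ≤ m) :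
    expand (X * ((V⁻¹ : 𝔤.Formalˣ) : 𝔤.Formal)) m n = expand X m n := by
  rw [expand_mul_eq_single p, hV.expand_inv_eq (by omega)]
  · rcases hm.eq_or_lt with rfl | hm
    · simp
    · rw [if_neg (by omega), mul_zero, hX m hm]
  · intro i hi
    rcases lt_or_gt_of_ne hi with h | h
    · rw [hV.expand_inv_eq (by omega), if_neg (by omega)]
      exact Or.inr rfl
    · exact Or.inl (hX i h)

/-- From the bottom degree downwards only the leading coefficient of `V⁻¹` enters, evaluated at `n +
p` because Λ^p has moved past it. -/
theorem InGPlus.expand_mul_inv {V : 𝔤.Formalˣ} (hV : InGPlus V) {X : 𝔤.Formal} {n p : ℤ}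
    (hX : ∀ i, i < p → expand X i n = 0) {m : ℤ} (hm : m ≤ p) :
    expand (X * ((V⁻¹ : 𝔤.Formalˣ) : 𝔤.Formal)) m n =
      expand X m n * expand ((V⁻¹ : 𝔤.Formalˣ) : 𝔤.Formal) 0 (n + p) := by
  rw [expand_mul_eq_single p]
  · rcases hm.eq_or_lt with rfl | hm
    · simp
    · rw [isPlus_iff.1 hV.2 _ (by omega), mul_zero, hX m hm, zero_mul]
  · intro i hi
    rcases lt_or_gt_of_ne hi with h | h
    · exact Or.inl (hX i h)
    · exact Or.inr (isPlus_iff.1 hV.2 _ (by omega) _)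

/-! ### Uniqueness for the linear problem and nonvanishing of leading coefficients. -/

namespace IsFactorization

variable {g : 𝔤.Eltˣ} {S Sbar : Charge N → 𝔤.Formalˣ}

/-- The factorization gives `W₀ g = S⁻¹ Sbar Wbar₀`; inserting this into the hypothesis and
cancelling `Wbar₀` on the right leaves the claim. -/
theorem mul_inv_eq (hS : 𝔤.IsFactorization g S Sbar) {s : Charge N} {Y Ybar : 𝔤.Formal}
    (h : Y * 𝔤.W₀ s * MvPowerSeries.C (g : 𝔤.Elt) = Ybar * 𝔤.Wbar₀ s) :
    Y * (((S s)⁻¹ : 𝔤.Formalˣ) : 𝔤.Formal) = Ybar * (((Sbar s)⁻¹ : 𝔤.Formalˣ) : 𝔤.Formal) := by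
  have h1 : Y * (((S s)⁻¹ : 𝔤.Formalˣ) : 𝔤.Formal) * (Sbar s : 𝔤.Formal) = Ybar := by
    apply mul_vacuum_right_cancel (e := Sum.inr) (ε := -1) (d := fun k => -s.1 (Sum.inr k))
    rw [← Wbar₀_eq_vacuum, ← h, _root_.mul_assoc, ← hS.eq, _root_.mul_assoc (S s : 𝔤.Formal),
      _root_.mul_assoc Y, Units.inv_mul_cancel_left, _root_.mul_assoc]
  rw [← h1, Units.mul_inv_cancel_right]

/-- A row of a solution of the linear problem vanishes once it is strictly lower triangular on one
side and upper triangular on the other. -/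
theorem expand_mul_W₀_eq_zero (hS : 𝔤.IsFactorization g S Sbar) {s : Charge N}
    {Y Ybar : 𝔤.Formal} {n : ℤ}
    (h : Y * 𝔤.W₀ s * MvPowerSeries.C (g : 𝔤.Elt) = Ybar * 𝔤.Wbar₀ s)
    (hY : ∀ m, 0 ≤ m → expand Y m n = 0) (hYbar : ∀ m < 0, expand Ybar m n = 0) (m : ℤ) :
    expand (Y * 𝔤.W₀ s) m n = 0 ∧ expand (Ybar * 𝔤.Wbar₀ s) m n = 0 := by
  have hZ := hS.mul_inv_eq h
  -- The common product is strictly lower triangular seen through `S` and upper triangular seen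
  -- through `Sbar`.
  have h0 : ∀ i, expand (Y * (((S s)⁻¹ : 𝔤.Formalˣ) : 𝔤.Formal)) i n = 0 := by
    intro i
    rcases lt_or_ge i 0 with hi | hi
    · rw [hZ, (hS.plus s).expand_mul_inv hYbar hi.le, hYbar i hi, zero_mul]
    · rw [(hS.minus s).expand_mul_inv (p := 0) (fun i hi => hY i hi.le) hi, hY i hi]
  have h1 : Y = Y * (((S s)⁻¹ : 𝔤.Formalˣ) : 𝔤.Formal) * (S s : 𝔤.Formal) := by rw [Units.inv_mul_cancel_right]
  have h2 : Ybar = Y * (((S s)⁻¹ : 𝔤.Formalˣ) : 𝔤.Formal) * (Sbar s : 𝔤.Formal) := by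
    rw [hZ, Units.inv_mul_cancel_right]
  constructor
  · rw [h1, _root_.mul_assoc]
    exact expand_mul_eq_zero h0 _ _
  · rw [h2, _root_.mul_assoc]
    exact expand_mul_eq_zero h0 _ _

variable [NeZero N]

theorem expand_single_mul (X : 𝔤.Formal) (m n : ℤ) (a b : Fin N) :
    expand (𝔤.formalConst 0 (Matrix.single 0 0 1) * X) m n a b =
      if a = 0 then expand X m n 0 b else 0 := by
  rw [expand_formalConst_mul, Matrix.map_single, map_one, sub_zero, add_zero]
  by_cases h : a = 0
  · subst h
    simp
  · rw [if_neg h, Matrix.single_mul_apply_of_ne _ _ _ _ _ h]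

/-- The linear relation between the first rows at two points of the zero charge sector. -/
theorem shifted_eq (hS : 𝔤.IsFactorization g S Sbar) (s s' : Charge N) :
    𝔤.formalConst 0 (Matrix.single 0 0 1) *
        ((S s' : 𝔤.Formal) * diag fun k => s'.1 (Sum.inl k) - s.1 (Sum.inl k)) * 𝔤.W₀ s *
        MvPowerSeries.C (g : 𝔤.Elt) =
      𝔤.formalConst 0 (Matrix.single 0 0 1) *
        ((Sbar s' : 𝔤.Formal) * diag fun k => s.1 (Sum.inr k) - s'.1 (Sum.inr k)) *
        𝔤.Wbar₀ s := by
  simp only [_root_.mul_assoc]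
  rw [← _root_.mul_assoc (diag _) (𝔤.W₀ s), ← W₀_eq_diag_mul, ← Wbar₀_eq_diag_mul, ← hS.eq,
    _root_.mul_assoc]

/-- Moving one unit of charge from 1 to `k` gives `Y = Y_0 S(s)` in the first row. The (1,1) entry
in degree -1 reads `1 = φ_{1,1k}(s') φ_{1,k1}(s)`, so the first factor is a unit. -/
theorem constantCoeff_phi_ne_zero (hS : 𝔤.IsFactorization g S Sbar) {k : Fin N} (hk : k ≠ 0)
    (s' : Charge N) (n : ℤ) : MvPowerSeries.constantCoeff (phi S 1 k s' n) ≠ 0 := by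
  obtain ⟨s, rfl⟩ : ∃ s, s' = shift (Sum.inl k, Sum.inl 0) 1 s :=
    ⟨shift (Sum.inl k, Sum.inl 0) (-1) s', by rw [shift_shift, add_neg_cancel, shift_zero]⟩
  set s' := shift (Sum.inl k, Sum.inl 0) 1 s with hs'
  have hrel := hS.shifted_eq s s'
  have hd : ∀ l, s'.1 (Sum.inl l) - s.1 (Sum.inl l) =
      (if l = k then 1 else 0) - if l = 0 then 1 else 0 := by
    intro l
    simp [hs', shift, Pi.single_apply]
    ring
  have hdbar : ∀ l, s.1 (Sum.inr l) - s'.1 (Sum.inr l) = 0 := by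
    intro l
    simp [hs', shift]
  set Y := 𝔤.formalConst 0 (Matrix.single 0 0 1) *
    ((S s' : 𝔤.Formal) * diag fun k => s'.1 (Sum.inl k) - s.1 (Sum.inl k)) with hY
  set Ybar := 𝔤.formalConst 0 (Matrix.single 0 0 1) *
    ((Sbar s' : 𝔤.Formal) * diag fun k => s.1 (Sum.inr k) - s'.1 (Sum.inr k)) with hYbar
  have hYe : ∀ i a b, expand Y i n a b = if a = 0 then expand (S s' : 𝔤.Formal)
      (i - ((if b = k then 1 else 0) - if b = 0 then 1 else 0)) n 0 b else 0 := by
    intro i a b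
    rw [hY, expand_single_mul, expand_mul_diag, hd]
  have hZ := hS.mul_inv_eq hrel
  have hYpos : ∀ i, 0 < i → expand Y i n = 0 := by
    intro i hi
    ext1 a b
    rw [hYe]
    split_ifs with ha hb hb' hb'
    · exact absurd (hb.symm.trans hb') hk
    · rw [(hS.minus s').expand_eq (by omega)]
      split_ifs
      · exact Matrix.one_apply_ne (Ne.symm hb')
      · rfl
    · rw [(hS.minus s').expand_eq (by omega), if_neg (by omega)]
      rfl
    · rw [(hS.minus s').expand_eq (by omega), if_neg (by omega)]
      rfl
    · rfl
  have hYbarneg : ∀ i, i < 0 → expand Ybar i n = 0 := by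
    intro i hi
    ext1 a b
    rw [hYbar, expand_single_mul, expand_mul_diag, hdbar, (hS.plus s').expand_eq_zero (by omega)]
    simp
  -- `Y S⁻¹` has no positive powers, and being `Ybar Sbar⁻¹` it has no negative ones.
  have hZ0 : ∀ i, i ≠ 0 → expand (Y * (((S s)⁻¹ : 𝔤.Formalˣ) : 𝔤.Formal)) i n = 0 := by
    intro i hi
    rcases lt_or_gt_of_ne hi with h | h
    · rw [hZ, (hS.plus s).expand_mul_inv hYbarneg h.le, hYbarneg i h, zero_mul]
    · rw [(hS.minus s).expand_mul_inv hYpos h.le, hYpos i h]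
  have h1 : expand (Y * (((S s)⁻¹ : 𝔤.Formalˣ) : 𝔤.Formal) * (S s : 𝔤.Formal)) (-1) n =
      expand Y 0 n * expand (S s : 𝔤.Formal) (-1) n := by
    rw [expand_mul_eq_single 0 fun i hi => Or.inl (hZ0 i hi),
      (hS.minus s).expand_mul_inv hYpos le_rfl, sub_zero, add_zero]
  rw [Units.inv_mul_cancel_right] at h1
  have h2 := congrFun (congrFun h1 0) 0
  rw [hYe, if_pos rfl, if_neg hk.symm, if_pos rfl, (hS.minus s').expand_eq (by norm_num),
    Matrix.mul_apply, Finset.sum_eq_single k] at h2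
  · rw [hYe, if_pos rfl, if_pos rfl, if_neg hk] at h2
    intro h3
    have h4 := congrArg MvPowerSeries.constantCoeff h2
    rw [map_mul] at h4
    change MvPowerSeries.constantCoeff (expand (S s' : 𝔤.Formal) (-((1 : ℕ) : ℤ)) n 0 k) = 0 at h3
    norm_num at h3 h4
    rw [h3] at h4
    simp at h4
  · intro l _ hl
    rw [hYe, if_pos rfl, if_neg hl, (hS.minus s').expand_eq (by split_ifs <;> norm_num)]
    rcases eq_or_ne l 0 with h | h
    · simp [h]
    · simp [h, Matrix.one_apply_ne h.symm]
  · simp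

/-- With one unit of charge moved from 1 to `k̄`, both expressions for `Y S⁻¹` have extreme degree
-1. The (1,1) entry there writes 1 as `φ̄_{0,1k}(s')` times an entry of the leading coefficient of
`Sbar(s)⁻¹`. -/
theorem constantCoeff_phiBar_ne_zero (hS : 𝔤.IsFactorization g S Sbar) (k : Fin N)
    (s' : Charge N) (n : ℤ) : MvPowerSeries.constantCoeff (phiBar Sbar 0 k s' n) ≠ 0 := by
  obtain ⟨s, rfl⟩ : ∃ s, s' = shift (Sum.inr k, Sum.inl 0) 1 s :=
    ⟨shift (Sum.inr k, Sum.inl 0) (-1) s', by rw [shift_shift, add_neg_cancel, shift_zero]⟩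
  set s' := shift (Sum.inr k, Sum.inl 0) 1 s with hs'
  have hrel := hS.shifted_eq s s'
  have hd : ∀ l, s'.1 (Sum.inl l) - s.1 (Sum.inl l) = -if l = 0 then 1 else 0 := by
    intro l
    simp [hs', shift, Pi.single_apply]
  have hdbar : ∀ l, s.1 (Sum.inr l) - s'.1 (Sum.inr l) = -if l = k then 1 else 0 := by
    intro l
    simp [hs', shift, Pi.single_apply]
  set Y := 𝔤.formalConst 0 (Matrix.single 0 0 1) *
    ((S s' : 𝔤.Formal) * diag fun k => s'.1 (Sum.inl k) - s.1 (Sum.inl k)) with hY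
  set Ybar := 𝔤.formalConst 0 (Matrix.single 0 0 1) *
    ((Sbar s' : 𝔤.Formal) * diag fun k => s.1 (Sum.inr k) - s'.1 (Sum.inr k)) with hYbar
  have hYe : ∀ i a b, expand Y i n a b = if a = 0 then expand (S s' : 𝔤.Formal)
      (i + if b = 0 then 1 else 0) n 0 b else 0 := by
    intro i a b
    rw [hY, expand_single_mul, expand_mul_diag, hd, sub_neg_eq_add]
  have hYbare : ∀ i a b, expand Ybar i n a b = if a = 0 then expand (Sbar s' : 𝔤.Formal)
      (i + if b = k then 1 else 0) n 0 b else 0 := by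
    intro i a b
    rw [hYbar, expand_single_mul, expand_mul_diag, hdbar, sub_neg_eq_add]
  have hZ := hS.mul_inv_eq hrel
  have hYpos : ∀ i, -1 < i → expand Y i n = 0 := by
    intro i hi
    ext1 a b
    rw [hYe]
    split_ifs with ha hb
    · rw [(hS.minus s').expand_eq (by omega), if_neg (by omega)]
      rfl
    · rw [(hS.minus s').expand_eq (by omega)]
      split_ifs
      · exact Matrix.one_apply_ne (Ne.symm hb)
      · rfl
    · rfl
  have hYbarneg : ∀ i, i < -1 → expand Ybar i n = 0 := by
    intro i hi
    ext1 a b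
    rw [hYbare, (hS.plus s').expand_eq_zero (by split_ifs <;> omega)]
    simp
  have h1 : expand Y (-1) n = expand Ybar (-1) n *
      expand (((Sbar s)⁻¹ : 𝔤.Formalˣ) : 𝔤.Formal) 0 (n + -1) := by
    rw [← (hS.minus s).expand_mul_inv hYpos le_rfl, hZ,
      (hS.plus s).expand_mul_inv hYbarneg le_rfl]
  have h2 := congrFun (congrFun h1 0) 0
  rw [hYe, if_pos rfl, if_pos rfl, (hS.minus s').expand_eq (by norm_num),
    Matrix.mul_apply, Finset.sum_eq_single k] at h2
  · rw [hYbare, if_pos rfl, if_pos rfl] at h2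
    intro h3
    have h4 := congrArg MvPowerSeries.constantCoeff h2
    rw [map_mul] at h4
    change MvPowerSeries.constantCoeff (expand (Sbar s' : 𝔤.Formal) ((0 : ℕ) : ℤ) n 0 k) = 0 at h3
    norm_num at h3 h4
    rw [h3] at h4
    simp at h4
  · intro l _ hl
    rw [hYbare, if_pos rfl, if_neg hl, (hS.plus s').expand_eq_zero (by norm_num)]
    simp
  · simp

end IsFactorization

end LaurentAlgebra

end Toda

/-! ### Residual of a scalar flow on the first rows. -/

namespace Toda

open LaurentAlgebra

theorem ShiftOp.act_eq_sum {N : ℕ} {K : Index N × Index N} {P : ShiftOp N} {A : Finset ℤ}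
    (hP : ∀ i ∉ A, P i = 0) (X : Charge N → FormalShiftSeries N) (s : Charge N) (m n : ℤ) :
    act K P X s m n = ∑ i ∈ A, P i s n • X (shift K i s) m n := by
  refine finsum_eq_sum_of_support_subset _ fun i hi => ?_
  by_contra h
  exact hi (by simp [hP i h])

/-- Every term of the residual is a right multiple of the same bare operator `V`, which can
therefore be factored out. -/
theorem pderivFun_row_sub {σ A ι : Type*} [Ring A] {x : σ} {E T V F : MvPowerSeries σ A}
    (hE : E.pderivFun x = 0) (hV : V.pderivFun x = F * V) (B : Finset ι)
    {c T' D V' : ι → MvPowerSeries σ A} (hV' : ∀ i, V' i = D i * V) :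
    (E * (T.pderivFun x + T * F) - ∑ i ∈ B, c i * (E * (T' i * D i))) * V =
      (E * (T * V)).pderivFun x - ∑ i ∈ B, c i * (E * (T' i * V' i)) := by
  rw [pderivFun_mul, pderivFun_mul, hE, hV, sub_mul, Finset.sum_mul]
  simp only [hV', mul_add, add_mul, _root_.mul_assoc, zero_mul, zero_add]

variable {N : ℕ} [NeZero N] {𝔤 : LaurentAlgebra N} {g : 𝔤.Eltˣ} {S Sbar : Charge N → 𝔤.Formalˣ}

/-- The flow of the first rows follows from triangularity of its coefficients, entry by entry. -/
theorem LaurentAlgebra.IsFactorization.deriv_firstRow_eq_act (hS : 𝔤.IsFactorization g S Sbar)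
    {K : Index N × Index N} {P : ShiftOp N} {A : Finset ℤ} (hP : ∀ i ∉ A, P i = 0) {j : ℕ+}
    {a : Index N} {s : Charge N} {n : ℤ}
    (hminus : ∀ m, 0 ≤ m → ∀ k, MvPowerSeries.pderiv ℂ (j, a) (expand (S s : 𝔤.Formal) m n 0 k) +
        (if Sum.inl k = a then expand (S s : 𝔤.Formal) (m - j) n 0 k else 0) =
      ∑ i ∈ A, P i s n * expand (S (shift K i s) : 𝔤.Formal)
        (m - ((shift K i s).1 (Sum.inl k) - s.1 (Sum.inl k))) n 0 k)
    (hplus : ∀ m < 0, ∀ k, MvPowerSeries.pderiv ℂ (j, a) (expand (Sbar s : 𝔤.Formal) m n 0 k) +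
        (if Sum.inr k = a then expand (Sbar s : 𝔤.Formal) (m + j) n 0 k else 0) =
      ∑ i ∈ A, P i s n * expand (Sbar (shift K i s) : 𝔤.Formal)
        (m - (s.1 (Sum.inr k) - (shift K i s).1 (Sum.inr k))) n 0 k) (m : ℤ) :
    (firstRow (W S) s).deriv (j, a) m n = ShiftOp.act K P (firstRow (W S)) s m n ∧
      (firstRow (Wbar Sbar) s).deriv (j, a) m n =
        ShiftOp.act K P (firstRow (Wbar Sbar)) s m n := by
  obtain ⟨F, hF, hFe⟩ := exists_pderivFun_W₀ (𝔤 := 𝔤) j a s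
  obtain ⟨G, hG, hGe⟩ := exists_pderivFun_Wbar₀ (𝔤 := 𝔤) j a s
  set E : 𝔤.Formal := 𝔤.formalConst 0 (Matrix.single 0 0 1) with hE
  set Y : 𝔤.Formal := E * ((S s : 𝔤.Formal).pderivFun (j, a) + S s * F) -
    ∑ i ∈ A, scalar (P i s n) * (E * ((S (shift K i s) : 𝔤.Formal) *
      diag fun k => (shift K i s).1 (Sum.inl k) - s.1 (Sum.inl k))) with hY
  set Ybar : 𝔤.Formal := E * ((Sbar s : 𝔤.Formal).pderivFun (j, a) + Sbar s * G) -
    ∑ i ∈ A, scalar (P i s n) * (E * ((Sbar (shift K i s) : 𝔤.Formal) *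
      diag fun k => s.1 (Sum.inr k) - (shift K i s).1 (Sum.inr k))) with hYbar
  have h1 : Y * 𝔤.W₀ s = (E * W S s).pderivFun (j, a) -
      ∑ i ∈ A, scalar (P i s n) * (E * W S (shift K i s)) := by
    exact pderivFun_row_sub (MvPowerSeries.pderivFun_C _) hF A fun i => W₀_eq_diag_mul s _
  have h2 : Ybar * 𝔤.Wbar₀ s = (E * Wbar Sbar s).pderivFun (j, a) -
      ∑ i ∈ A, scalar (P i s n) * (E * Wbar Sbar (shift K i s)) := by
    exact pderivFun_row_sub (MvPowerSeries.pderivFun_C _) hG A fun i => Wbar₀_eq_diag_mul s _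
  have hWg : ∀ s, W S s * MvPowerSeries.C (g : 𝔤.Elt) = Wbar Sbar s := hS.eq
  -- Scalar coefficients and shifts of the charge act on the left, and `g` is independent of charges
  -- and times, so right multiplication by `g` commutes with the whole flow.
  have h3 : Y * 𝔤.W₀ s * MvPowerSeries.C (g : 𝔤.Elt) = Ybar * 𝔤.Wbar₀ s := by
    rw [h1, h2, sub_mul, Finset.sum_mul]
    congr 1
    · rw [← hWg, ← _root_.mul_assoc, pderivFun_mul _ (E * W S s), MvPowerSeries.pderivFun_C,
        mul_zero, add_zero]
    · refine Finset.sum_congr rfl fun i _ => ?_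
      rw [← hWg]
      simp only [_root_.mul_assoc]
  have h4 := hS.expand_mul_W₀_eq_zero (n := n) h3 ?_ ?_ m
  · rw [h1, h2] at h4
    rw [ShiftOp.act_eq_sum hP, ShiftOp.act_eq_sum hP]
    simp only [expand_sub, expand_sum, Pi.sub_apply, Finset.sum_apply, expand_scalar_mul,
      expand_pderivFun, sub_eq_zero] at h4
    exact h4
  · intro m hm
    ext1 b k
    rw [hY, expand_sub, expand_sum, Pi.sub_apply, Pi.sub_apply, Finset.sum_apply,
      Finset.sum_apply, Matrix.sub_apply, Matrix.sum_apply]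
    simp only [expand_scalar_mul, Matrix.smul_apply, hE, IsFactorization.expand_single_mul,
      expand_mul_diag, expand_add, Pi.add_apply, Matrix.add_apply, hFe, expand_pderivFun]
    rcases eq_or_ne b 0 with rfl | hb
    · simp only [if_true, smul_eq_mul, ← hminus m hm k]
      exact sub_self _
    · simp [hb]
  · intro m hm
    ext1 b k
    rw [hYbar, expand_sub, expand_sum, Pi.sub_apply, Pi.sub_apply, Finset.sum_apply,
      Finset.sum_apply, Matrix.sub_apply, Matrix.sum_apply]
    simp only [expand_scalar_mul, Matrix.smul_apply, hE, IsFactorization.expand_single_mul,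
      expand_mul_diag, expand_add, Pi.add_apply, Matrix.add_apply, hGe, expand_pderivFun]
    rcases eq_or_ne b 0 with rfl | hb
    · simp only [if_true, smul_eq_mul, ← hplus m hm k]
      exact sub_self _
    · simp [hb]

/-! ### The scalar dressing operators -/

/-- This lemma and the next two read columns of `S` and `Sbar` as dressing operators in every
degree. The exponent is unchanged in column 1, offset by one in the other columns of `S`, whose
degree 0 entry vanishes, and negated for `Sbar`. -/
theorem dressing_inl_zero (hS : 𝔤.IsFactorization g S Sbar) (m : ℤ) (s : Charge N) (n : ℤ) :
    dressing S Sbar (Sum.inl 0) m s n = expand (S s : 𝔤.Formal) m n 0 0 := by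
  rcases lt_trichotomy m 0 with hm | rfl | hm
  · obtain ⟨i, rfl⟩ : ∃ i : ℕ, m = -(i : ℤ) := ⟨(-m).toNat, by omega⟩
    have hi : i ≠ 0 := by omega
    rw [dressing, ShiftOp.lower_neg]
    simp [dressingCoeff, hi, phi]
  · rw [dressing, ShiftOp.lower_zero, (hS.minus s).expand_eq le_rfl]
    simp [dressingCoeff]
  · rw [dressing, ShiftOp.degreeLE_lower _ m hm, (hS.minus s).expand_eq hm.le, if_neg hm.ne']
    rfl

theorem dressing_inl (hS : 𝔤.IsFactorization g S Sbar) {k : Fin N} (hk : k ≠ 0) (m : ℤ)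
    (s : Charge N) (n : ℤ) :
    dressing S Sbar (Sum.inl k) m s n = expand (S s : 𝔤.Formal) (m - 1) n 0 k := by
  rcases lt_or_ge 0 m with hm | hm
  · rw [dressing, ShiftOp.degreeLE_lower _ m hm, (hS.minus s).expand_eq (by omega)]
    split_ifs
    · exact (Matrix.one_apply_ne hk.symm).symm
    · rfl
  · obtain ⟨i, rfl⟩ : ∃ i : ℕ, m = -(i : ℤ) := ⟨(-m).toNat, by omega⟩
    rw [dressing, ShiftOp.lower_neg]
    simp only [dressingCoeff, hk, if_false, phi]
    congr 2
    push_cast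
    ring

theorem dressing_inr (hS : 𝔤.IsFactorization g S Sbar) (k : Fin N) (m : ℤ) (s : Charge N) (n : ℤ) :
    dressing S Sbar (Sum.inr k) m s n = expand (Sbar s : 𝔤.Formal) (-m) n 0 k := by
  rcases lt_or_ge 0 m with hm | hm
  · rw [dressing, ShiftOp.degreeLE_lower _ m hm, (hS.plus s).expand_eq_zero (by omega)]
    rfl
  · obtain ⟨i, rfl⟩ : ∃ i : ℕ, m = -(i : ℤ) := ⟨(-m).toNat, by omega⟩
    rw [dressing, ShiftOp.lower_neg, neg_neg]
    rfl

theorem constantCoeff_dressingCoeff_ne_zero (hS : 𝔤.IsFactorization g S Sbar) (a : Index N)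
    (s : Charge N) (n : ℤ) :
    MvPowerSeries.constantCoeff (dressingCoeff S Sbar a 0 s n) ≠ 0 := by
  rcases a with k | k
  · by_cases hk : k = 0
    · simp [dressingCoeff, hk]
    · simpa [dressingCoeff, hk] using hS.constantCoeff_phi_ne_zero hk s n
  · exact hS.constantCoeff_phiBar_ne_zero k s n

/-- In the grading of the dressing operators, the exponents `≥ threshold x` in column `x` are those
that do not occur in a strictly lower triangular row (`x ∈ 𝕊`), respectively in an upper triangular
row (`x ∈ 𝕊̄`). -/
def threshold (x : Index N) : ℤ := if x = Sum.inl 0 then 0 else 1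

theorem dressing_inl_zero_zero : dressing S Sbar (Sum.inl 0) 0 = fun _ _ => 1 := by
  rw [dressing, ShiftOp.lower_zero]
  funext s n
  simp [dressingCoeff]

/-- From the threshold on, the only coefficient that can be nonzero is the constant 1 in column 1.
-/
theorem pderiv_dressing_eq_zero {x : Index N} {m : ℤ} (hm : threshold x ≤ m) (s : Charge N) (n : ℤ)
    (y : Time N) : MvPowerSeries.pderiv ℂ y (dressing S Sbar x m s n) = 0 := by
  rcases lt_or_ge 0 m with h | h
  · rw [dressing, ShiftOp.degreeLE_lower _ m h]
    exact map_zero _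
  · have hx : x = Sum.inl 0 := by
      by_contra hx
      rw [threshold, if_neg hx] at hm
      omega
    rw [threshold, if_pos hx] at hm
    rw [le_antisymm h hm, hx, dressing_inl_zero_zero]
    exact MvPowerSeries.pderiv_one

theorem degreeLE_lax (K : Index N × Index N) (S Sbar : Charge N → 𝔤.Formalˣ) (a : Index N) :
    (lax K S Sbar a).DegreeLE 1 := by
  simpa using! ((ShiftOp.degreeLE_lower _).comp ShiftOp.degreeLE_T).comp
    (ShiftOp.degreeLE_lower _) (K := K)

/-- Triangularity of the difference between a flow and a truncation of the power of a Lax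
operator. -/
theorem dressing_flow (hS : 𝔤.IsFactorization g S Sbar) {a b : Index N} (hab : a ≠ b)
    {P : ShiftOp N} {j : ℕ+} {s : Charge N} {n : ℤ}
    (hPa : ∀ i, threshold a ≤ i → P i = ShiftOp.pow (a, b) (lax (a, b) S Sbar a) j i)
    (hPb : b = Sum.inl 0 → P 0 s n = 0)
    (hPs : a ≠ Sum.inl 0 → b ≠ Sum.inl 0 → ∑ i ∈ Finset.Icc 0 (j : ℤ), P i s n = 0)
    {x : Index N} {m : ℤ} (hm : threshold x ≤ m) :
    MvPowerSeries.pderiv ℂ (j, a) (dressing S Sbar x m s n) +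
        (if x = a then dressing S Sbar x (m - j) s n else 0) =
      ∑ i ∈ Finset.Icc 0 (j : ℤ), P i s n * dressing S Sbar x
        (m - (if x = a then i else 0) + if x = b then i else 0) (shift (a, b) i s) n := by
  have hdeg : (dressing S Sbar x).DegreeLE 0 := ShiftOp.degreeLE_lower _
  have h0 : 0 ≤ m := by
    rw [threshold] at hm
    split_ifs at hm <;> omega
  rw [pderiv_dressing_eq_zero hm, zero_add]
  by_cases hxa : x = a
  · subst hxa
    simp only [if_true, hab, if_false, add_zero]
    -- Intertwining `L^j K = K T^j`: its right side is the term coming from the derivative of the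
    -- bare exponential.
    have hpow : ShiftOp.comp (x, b) (ShiftOp.pow (x, b) (lax (x, b) S Sbar x) j)
        (dressing S Sbar x) m = dressing S Sbar x (m - (j : ℕ)) := ShiftOp.pow_conj_comp (K := (x, b)) hdeg (ShiftOp.degreeLE_lower _)
      (ShiftOp.comp_invCoeff_lower (constantCoeff_dressingCoeff_ne_zero hS x)) j m
    rw [← hpow, ShiftOp.comp_eq_sum ((degreeLE_lax (x, b) S Sbar x).pow j) hdeg
      (A := Finset.Icc 0 (j : ℤ)) (Finset.Icc_subset_Icc_left (by omega))]
    refine Finset.sum_congr rfl fun i hi => ?_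
    rw [Finset.mem_Icc] at hi
    -- Where `P` differs from `L^j`, one has `i < threshold x ≤ m`, and the dressing coefficient of
    -- positive degree `m - i` vanishes.
    by_cases hti : threshold x ≤ i
    · rw [hPa i hti]
    · rw [hdeg (m - i) (by omega)]
      simp
  simp only [hxa, if_false, sub_zero]
  symm
  by_cases hxb : x = b
  · subst hxb
    simp only [if_true]
    refine Finset.sum_eq_zero fun i hi => ?_
    rw [Finset.mem_Icc] at hi
    -- Both `m` and `i` are nonnegative, so only `m = i = 0` survives; the threshold then forces `x
    -- = 1`.
    by_cases hmi : 0 < m + i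
    · rw [hdeg _ hmi]
      simp
    · have hi0 : i = 0 := by omega
      have hx : x = Sum.inl 0 := by
        by_contra hx
        rw [threshold, if_neg hx] at hm
        omega
      rw [hi0, hPb hx, zero_mul]
  simp only [hxb, if_false, add_zero]
  rcases h0.lt_or_eq with h | rfl
  · rw [hdeg m h]
    simp
  · have hx : x = Sum.inl 0 := by
      by_contra hx
      rw [threshold, if_neg hx] at hm
      omega
    subst hx
    -- The leading coefficient 1 is the same at all charges, so what remains is the sum of the
    -- coefficients of `P`.
    rw [dressing_inl_zero_zero, ← Finset.sum_mul, hPs (Ne.symm hxa) (Ne.symm hxb), zero_mul]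

theorem deriv_firstRow_eq_act_of_truncation (hS : 𝔤.IsFactorization g S Sbar) {a b : Index N}
    (hab : a ≠ b) {P : ShiftOp N} {j : ℕ+} (hP : ∀ i ∉ Finset.Icc 0 (j : ℤ), P i = 0)
    (hPa : ∀ i, threshold a ≤ i → P i = ShiftOp.pow (a, b) (lax (a, b) S Sbar a) j i)
    (hPb : b = Sum.inl 0 → P 0 = 0)
    (hPs : a ≠ Sum.inl 0 → b ≠ Sum.inl 0 → ∀ s n, ∑ i ∈ Finset.Icc 0 (j : ℤ), P i s n = 0)
    (s : Charge N) :
    (firstRow (W S) s).deriv (j, a) = ShiftOp.act (a, b) P (firstRow (W S)) s ∧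
      (firstRow (Wbar Sbar) s).deriv (j, a) = ShiftOp.act (a, b) P (firstRow (Wbar Sbar)) s := by
  have key : ∀ (m n : ℤ) (x : Index N), threshold x ≤ m → _ := fun m n x hm =>
    dressing_flow hS hab (s := s) (n := n) hPa (fun h => by rw [hPb h]; rfl)
      (fun h h' => hPs h h' s n) (x := x) hm
  have hshift : ∀ (i : ℤ) (x : Index N), (shift (a, b) i s).1 x - s.1 x =
      (if x = a then i else 0) - if x = b then i else 0 := by
    intro i x
    simp only [shift, Pi.sub_apply, Pi.add_apply, Pi.single_apply]
    ring
  have main := fun m n : ℤ => hS.deriv_firstRow_eq_act (K := (a, b)) hP (j := j) (a := a) (s := s)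
    (n := n) ?_ ?_ m
  · exact ⟨funext fun m => funext fun n => (main m n).1,
      funext fun m => funext fun n => (main m n).2⟩
  · intro m hm k
    by_cases hk : k = 0
    · subst hk
      have h := key m n (Sum.inl 0) (by simpa [threshold] using hm)
      simp only [dressing_inl_zero hS] at h
      simpa only [hshift, sub_sub_eq_add_sub, sub_add_eq_add_sub] using h
    -- The degree is raised by one to match the offset in the columns `k ≠ 1` of `S`.
    · have h := key (m + 1) n (Sum.inl k) (by simp [threshold, hk, hm])
      simp only [dressing_inl hS hk] at h
      rw [add_sub_cancel_right, show m + 1 - (j : ℤ) - 1 = m - j by ring] at h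
      rw [h]
      refine Finset.sum_congr rfl fun i _ => ?_
      have hi : m + 1 - (if Sum.inl k = a then i else 0) + (if Sum.inl k = b then i else 0) - 1 =
          m - ((shift (a, b) i s).1 (Sum.inl k) - s.1 (Sum.inl k)) := by
        rw [hshift]
        ring
      rw [hi]
  · intro m hm k
    have h := key (-m) n (Sum.inr k) (by simp only [threshold, reduceCtorEq, if_false]; omega)
    simp only [dressing_inr hS] at h
    rw [neg_neg, show -(-m - (j : ℤ)) = m + j by ring] at h
    rw [h]
    refine Finset.sum_congr rfl fun i _ => ?_
    have hi : -(-m - (if Sum.inr k = a then i else 0) + (if Sum.inr k = b then i else 0)) =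
        m - (s.1 (Sum.inr k) - (shift (a, b) i s).1 (Sum.inr k)) := by
      rw [← neg_sub ((shift (a, b) i s).1 _), hshift]
      ring
    rw [hi]

theorem pow_lax_degreeLE (K : Index N × Index N) (S Sbar : Charge N → 𝔤.Formalˣ) (a : Index N)
    (j : ℕ+) : (ShiftOp.pow K (lax K S Sbar a) j).DegreeLE (j : ℤ) :=
  (degreeLE_lax K S Sbar a).pow j

end Toda

/-! ### The projections and the resulting flows. -/

namespace Toda

variable {N : ℕ}

theorem projGe_eq_zero {P : ShiftOp N} {j : ℤ} (hP : P.DegreeLE j) :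
    ∀ i ∉ Finset.Icc 0 j, P.projGe i = 0 := by
  intro i hi
  rw [ShiftOp.projGe]
  split_ifs with h
  · exact hP i (by simpa [h] using hi)
  · rfl

theorem projGt_eq_zero {P : ShiftOp N} {j : ℤ} (hP : P.DegreeLE j) :
    ∀ i ∉ Finset.Icc 0 j, P.projGt i = 0 := by
  intro i hi
  rw [ShiftOp.projGt]
  split_ifs with h
  · exact hP i (by simpa [h.le] using hi)
  · rfl

theorem projGtSubOne_eq_zero {P : ShiftOp N} {j : ℤ} (hP : P.DegreeLE j) (hj : 0 ≤ j) :
    ∀ i ∉ Finset.Icc 0 j, P.projGtSubOne i = 0 := by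
  intro i hi
  funext s n
  rw [ShiftOp.projGtSubOne]
  split_ifs with h h'
  · rw [hP i (by simpa [h.le] using hi)]
  · simp [h', hj] at hi
  · rfl

/-- Each `T^i - 1` annihilates constants; in coefficients, the term of index 0 is minus the sum of
the positive ones. -/
theorem sum_projGtSubOne {P : ShiftOp N} {j : ℤ} (hP : P.DegreeLE j) (hj : 0 ≤ j) (s : Charge N)
    (n : ℤ) : ∑ i ∈ Finset.Icc 0 j, P.projGtSubOne i s n = 0 := by
  have hsum : ∑ᶠ l : ℤ, (if 0 < l then P l s n else 0) = ∑ l ∈ Finset.Ioc 0 j, P l s n := by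
    rw [finsum_eq_sum_of_support_subset (s := Finset.Ioc 0 j)]
    · exact Finset.sum_congr rfl fun l hl => if_pos (Finset.mem_Ioc.1 hl).1
    · intro l hl
      rw [Function.mem_support] at hl
      rw [Finset.mem_coe, Finset.mem_Ioc]
      by_contra h
      apply hl
      split_ifs with h0
      · rw [hP l (by omega)]
        rfl
      · rfl
  rw [← Finset.Ioc_insert_left hj, Finset.sum_insert (by simp)]
  have h0 : P.projGtSubOne 0 s n = -∑ l ∈ Finset.Ioc 0 j, P l s n := by
    rw [← hsum]
    simp [ShiftOp.projGtSubOne]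
  rw [h0, neg_add_eq_zero]
  exact Finset.sum_congr rfl fun l hl => by
    rw [ShiftOp.projGtSubOne, if_pos (Finset.mem_Ioc.1 hl).1]

variable [NeZero N] {𝔤 : LaurentAlgebra N} {g : 𝔤.Eltˣ} {S Sbar : Charge N → 𝔤.Formalˣ}

open LaurentAlgebra

theorem deriv_firstRow_eq_laxFlow (hS : 𝔤.IsFactorization g S Sbar) {a₀ : Index N}
    (ha₀ : a₀ ≠ Sum.inl 0) (a : Index N) (j : ℕ+) (s : Charge N) :
    (firstRow (W S) s).deriv (j, a) = laxFlow a₀ S Sbar j a (firstRow (W S)) s ∧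
      (firstRow (Wbar Sbar) s).deriv (j, a) =
        laxFlow a₀ S Sbar j a (firstRow (Wbar Sbar)) s := by
  unfold laxFlow
  by_cases ha : a = Sum.inl 0
  · subst ha
    simp only [pair, proj, if_true]
    refine deriv_firstRow_eq_act_of_truncation hS ha₀.symm
      (projGe_eq_zero (pow_lax_degreeLE _ _ _ _ _)) (fun i hi => ?_) (fun h => absurd h ha₀)
      (fun h => absurd rfl h) s
    rw [ShiftOp.projGe, if_pos (by simpa [threshold] using hi)]
  · simp only [pair, proj, if_neg ha]
    refine deriv_firstRow_eq_act_of_truncation hS ha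
      (projGt_eq_zero (pow_lax_degreeLE _ _ _ _ _)) (fun i hi => ?_) (fun _ => ?_)
      (fun _ h => absurd rfl h) s
    · rw [threshold, if_neg ha] at hi
      rw [ShiftOp.projGt, if_pos (by omega)]
    · simp [ShiftOp.projGt]

theorem deriv_firstRow_eq_laxFlowBar (hS : 𝔤.IsFactorization g S Sbar) {b₀ : Index N}
    (hb₀ : b₀ ≠ Sum.inr 0) (a : Index N) (j : ℕ+) (s : Charge N) :
    (firstRow (W S) s).deriv (j, a) = laxFlowBar b₀ S Sbar j a (firstRow (W S)) s ∧
      (firstRow (Wbar Sbar) s).deriv (j, a) =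
        laxFlowBar b₀ S Sbar j a (firstRow (Wbar Sbar)) s := by
  unfold laxFlowBar
  have hj : (0 : ℤ) ≤ j := by positivity
  -- The case where neither index of the shift is 1: subtracting 1 from each power is what preserves
  -- the leading 1 of column 1.
  have hsub : ∀ {b : Index N}, a ≠ b → a ≠ Sum.inl 0 → b ≠ Sum.inl 0 →
      (firstRow (W S) s).deriv (j, a) = ShiftOp.act (a, b)
          (ShiftOp.pow (a, b) (lax (a, b) S Sbar a) j).projGtSubOne (firstRow (W S)) s ∧
        (firstRow (Wbar Sbar) s).deriv (j, a) = ShiftOp.act (a, b)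
          (ShiftOp.pow (a, b) (lax (a, b) S Sbar a) j).projGtSubOne (firstRow (Wbar Sbar)) s := by
    intro b hab ha hb
    have hdeg := pow_lax_degreeLE (a, b) S Sbar a j
    refine deriv_firstRow_eq_act_of_truncation hS hab (projGtSubOne_eq_zero hdeg hj)
      (fun i hi => ?_) (fun h => absurd h hb) (fun _ _ => sum_projGtSubOne hdeg hj) s
    rw [threshold, if_neg ha] at hi
    funext s n
    rw [ShiftOp.projGtSubOne, if_pos (by omega)]
  by_cases ha : a = Sum.inl 0
  · subst ha
    simp only [pairBar, projBar, if_true, reduceCtorEq, if_false]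
    refine deriv_firstRow_eq_act_of_truncation hS (by simp)
      (projGe_eq_zero (pow_lax_degreeLE _ _ _ _ _)) (fun i hi => ?_) (fun h => by simp at h)
      (fun h => absurd rfl h) s
    rw [ShiftOp.projGe, if_pos (by simpa [threshold] using hi)]
  by_cases ha' : a = Sum.inr 0
  · by_cases hb : b₀ = Sum.inl 0
    · simp only [pairBar, projBar, if_neg ha, if_pos ha', if_pos (And.intro ha' hb)]
      subst hb
      refine deriv_firstRow_eq_act_of_truncation hS ha
        (projGt_eq_zero (pow_lax_degreeLE _ _ _ _ _)) (fun i hi => ?_) (fun _ => ?_)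
        (fun _ h => absurd rfl h) s
      · rw [threshold, if_neg ha] at hi
        rw [ShiftOp.projGt, if_pos (by omega)]
      · simp [ShiftOp.projGt]
    · simp only [pairBar, projBar, if_neg ha, if_pos ha', if_neg fun h => hb (And.right h)]
      exact hsub (fun h => hb₀ (h ▸ ha')) ha hb
  · simp only [pairBar, projBar, if_neg ha, if_neg ha', if_neg fun h => ha' (And.left h)]
    exact hsub ha' ha (by simp)

end Toda

end

theorem mainTheorem1 (N : ℕ) [NeZero N] (𝔤 : Toda.LaurentAlgebra N) (g : 𝔤.Eltˣ)
    (S Sbar : Toda.Charge N → 𝔤.Formalˣ) (hS : 𝔤.IsFactorization g S Sbar)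
    (a₀ : Toda.Index N) (ha₀ : a₀ ≠ Sum.inl 0) (b₀ : Toda.Index N) (hb₀ : b₀ ≠ Sum.inr 0)
    (a : Toda.Index N) :
    (∀ K ∈ ({Toda.pair a₀ a, Toda.pairBar b₀ a} : Set (Toda.Index N × Toda.Index N)),
      Toda.ShiftOp.comp K (Toda.dressing S Sbar a) (Toda.dressingInv K S Sbar a)
          = Toda.ShiftOp.one ∧
        Toda.ShiftOp.comp K (Toda.dressingInv K S Sbar a) (Toda.dressing S Sbar a)
          = Toda.ShiftOp.one) ∧
    ∀ (j : ℕ+) (s : Toda.Charge N),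
      (Toda.LaurentAlgebra.firstRow (Toda.LaurentAlgebra.W S) s).deriv (j, a)
          = Toda.laxFlow a₀ S Sbar j a
              (Toda.LaurentAlgebra.firstRow (Toda.LaurentAlgebra.W S)) s ∧
      (Toda.LaurentAlgebra.firstRow (Toda.LaurentAlgebra.W S) s).deriv (j, a)
          = Toda.laxFlowBar b₀ S Sbar j a
              (Toda.LaurentAlgebra.firstRow (Toda.LaurentAlgebra.W S)) s ∧
      (Toda.LaurentAlgebra.firstRow (Toda.LaurentAlgebra.Wbar Sbar) s).deriv (j, a)
          = Toda.laxFlow a₀ S Sbar j a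
              (Toda.LaurentAlgebra.firstRow (Toda.LaurentAlgebra.Wbar Sbar)) s ∧
      (Toda.LaurentAlgebra.firstRow (Toda.LaurentAlgebra.Wbar Sbar) s).deriv (j, a)
          = Toda.laxFlowBar b₀ S Sbar j a
              (Toda.LaurentAlgebra.firstRow (Toda.LaurentAlgebra.Wbar Sbar)) s := by

  have hc := Toda.constantCoeff_dressingCoeff_ne_zero hS a
  exact ⟨fun K _ => ⟨Toda.ShiftOp.comp_lower_invCoeff hc, Toda.ShiftOp.comp_invCoeff_lower hc⟩,
    fun j s => ⟨(Toda.deriv_firstRow_eq_laxFlow hS ha₀ a j s).1,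
      (Toda.deriv_firstRow_eq_laxFlowBar hS hb₀ a j s).1,
      (Toda.deriv_firstRow_eq_laxFlow hS ha₀ a j s).2,
      (Toda.deriv_firstRow_eq_laxFlowBar hS hb₀ a j s).2⟩⟩
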